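/- **Setting.** Let $\mathcal V$ be a countably infinite set of variables, $\mathcal F$ a signature and $\mathcal R$ a term rewrite system (TRS) over $\mathcal F$: finitely many rules $l\to r$ with $l\notin\mathcal V$ and $\mathrm{Var}(r)\subseteq\mathrm{Var}(l)$. Let $\mathcal D$ be the set of defined symbols (roots of left-hand sides of $\mathcal R$); the other symbols of $\mathcal F$ are constructors. A term $f(t_1,\dots,t_n)$ is basic if $f\in\mathcal D$ and all $t_i$ are built from constructors and variables. The (innermost) runtime complexity $\mathrm{rc}^{(\mathrm i)}_{\mathcal R}(n)$ is the maximal length of an (innermost) $\mathcal R$-derivation starting from a basic term of size at most $n$. **Dependency pairs.** For each $f\in\mathcal F$ let $f^\sharp$ be a new symbol of the same arity; $t^\sharp$ is $t$ with its root symbol $f$ replaced by $f^\sharp$, and $x^\sharp=x$ for variables. For a rule $l\to r$ of $\mathcal R$ let $u_1,\dots,u_n$ be the outermost subterm occurrences of $r$, from left to right, whose root is in $\mathcal D\cup\mathcal V$ (innermost case: in $\mathcal D$). Its weak (innermost) dependency pair is $l^\sharp\to\mathrm{COM}(u_1^\sharp,\dots,u_n^\sharp)$, where $\mathrm{COM}(s)=s$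 for $n=1$ and $\mathrm{COM}(s_1,\dots,s_n)=c(s_1,\dots,s_n)$ with a fresh compound symbol $c$ otherwise. Let $\mathcal P$ be the set of all weak (innermost) dependency pairs. Write $f\rhd g$ if some rule $l\to r\in\mathcal R$ has root$(l)=f$ and $g\in\mathcal D$ occurs in $r$; let $\mathcal U(\mathcal P)$ be the set of rules of $\mathcal R$ whose left-hand side has root $g$ with $f\rhd^* g$ for some symbol $f$ occurring in a right-hand side of $\mathcal P$. **Replacement maps.** For a TRS $\mathcal Q$ and a replacement map $\mu$ (a set $\mu(f)$ of argument positions for each $f$) let $$\Upsilon^{\mathcal Q}(\mu)=\{(f,i)\mid l\to C[f(r_1,\dots,r_n)]\in\mathcal Q,\ \mathrm{CAP}_\mu^l(r_i)\ne r_i\},$$ where $\mathrm{CAP}_\mu^s(t)=t$ if $t$ is the subterm of $s$ at a position that is not $\mu$-replacing; otherwise $\mathrm{CAP}_\mu^s(t)=u$ if $t=f(t_1,\dots,t_n)$ and $u=f(\mathrm{CAP}_\mu^s(t_1),\dots,\mathrm{CAP}_\mu^s(t_n))$ unifies with no (variable-disjointly renamed) left-hand side of $\mathcal Q$; otherwise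 it is a fresh variable. The usable replacement map of $\mathcal Q$ is the least fixed point of $\Upsilon^{\mathcal Q}$, the innermost usable replacement map is $\Upsilon^{\mathcal Q}(\varnothing)$. Let $\mu$ be the (innermost) usable replacement map of $\mathcal P\cup\mathcal U(\mathcal P)$. **Matrix interpretations.** A matrix interpretation $\mathcal A$ of dimension $d\ge1$ interprets each symbol $f$ by $f_{\mathcal A}(\vec v_1,\dots,\vec v_n)=F_1\vec v_1+\dots+F_n\vec v_n+\vec f$ with $F_i\in\mathbb N^{d\times d}$, $\vec f\in\mathbb N^d$. On $\mathbb N^d$, $\ge$ is componentwise, and $x>y$ means $x_1>y_1$ and $x\ge y$; write $s>_{\mathcal A}t$ (resp. $s\geqslant_{\mathcal A}t$) if $[\alpha]_{\mathcal A}(s)>[\alpha]_{\mathcal A}(t)$ (resp. $\ge$) for all assignments $\alpha$. It is $\mu$-monotone if every $f_{\mathcal A}$ is strictly monotone with respect to $>$ in the arguments in $\mu(f)$. It is a restricted matrix interpretation (RMI) if all matrices $F_i$ of constructors $f$ of $\mathcal R$ are upper triangular with diagonal entries at most $1$. It is adequate if all matrices of compound symbols are unit matrices. It is of basic degree $k$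 if there is a constant $c$ with $[\alpha_0]_{\mathcal A}(t^\sharp)_j\le c\,|t^\sharp|^k$ for all basic $t$ and all $j$, where $\alpha_0=\vec 0$. Its weight gap is $\mathrm{WG}(\mathcal A,\mathcal P)=\max\{[\alpha]_{\mathcal A}(r)_1\mathbin{\dot-}[\alpha]_{\mathcal A}(l)_1\mid l\to r\in\mathcal P,\ \alpha \text{ an assignment}\}$, which is well-defined if these numbers are bounded. A $\mu$-complexity pair for $\mathcal P/\mathcal U(\mathcal P)$ is a pair $(\gtrsim,\succ)$ of a $\mu$-monotone quasi-order and a strict order on terms such that ${\gtrsim}\cdot{\succ}\subseteq{\succ}$ or ${\succ}\cdot{\gtrsim}\subseteq{\succ}$; some map $G$ from terms to $\mathbb N$ satisfies $G(s)>G(t)$ whenever $s\succ t$ and $s\to^*_{\mathcal U(\mathcal P)}\cdot\to_{\mathcal P}\cdot\to^*_{\mathcal U(\mathcal P)}t$; and $\succ$ is monotone in the arguments in $\mu(c)$ of every compound symbol $c$. **Corollary.** Let $\mathcal B$ be an RMI such that $(\geqslant_{\mathcal B},>_{\mathcal B})$ is a $\mu$-complexity pair for $\mathcal P/\mathcal U(\mathcal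 P)$ with $\mathcal U(\mathcal P)\subseteq{\geqslant_{\mathcal B}}$ and $\mathcal P\subseteq{>_{\mathcal B}}$. Let $\mathcal A$ be an adequate $\mu$-monotone RMI such that $\mathrm{WG}(\mathcal A,\mathcal P)$ is well-defined and $\mathcal U(\mathcal P)\subseteq{>_{\mathcal A}}$. Then the (innermost) runtime complexity of $\mathcal R$ is polynomial, of degree the maximum of the degrees of $\mathcal A$ and $\mathcal B$. Precisely: 1. if $\mathcal A$ and $\mathcal B$ are of basic degree $k_{\mathcal A}$ and $k_{\mathcal B}$, then there is a polynomial $p$ of degree at most $\max(k_{\mathcal A},k_{\mathcal B})$ with $\mathrm{rc}^{(\mathrm i)}_{\mathcal R}(n)\le p(n)$ for all $n$; 2. there is always such a polynomial of degree at most $\max(d_{\mathcal A},d_{\mathcal B})$, where $d_{\mathcal A}$ (and likewise $d_{\mathcal B}$) is the number of indices $j$ such that some matrix used by $\mathcal A$ for a constructor of $\mathcal R$ has entry $1$ at $(j,j)$. Both the full and the innermost version are asserted. In particular $\mathrm{rc}^{(\mathrm i)}_{\mathcal R}(n)$ is finite for all $n$. -/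

import Mathlib

universe u v w

namespace Rewriting

open Classical Matrix

/-! ### Terms, rules and rewriting -/

/-- A signature: function symbols together with their arities. -/
structure Signature where
  symbol : Type u
  arity : symbol → ℕ

/-- First-order terms over the signature `S` and the variables `V`. -/
inductive Term (S : Signature.{u}) (V : Type v) : Type (max u v)
  | var (x : V) : Term S V
  | app (f : S.symbol) (ts : Fin (S.arity f) → Term S V) : Term S V

namespace Term

variable {S : Signature.{u}} {V : Type v}

/-- The number of symbols of a term. -/
def size : Term S V → ℕ
  | var _ => 1
  | app _ ts => 1 + ∑ i, (ts i).size

/-- The variables occurring in a term. -/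
def vars : Term S V → Set V
  | var x => {x}
  | app _ ts => ⋃ i, (ts i).vars

/-- The function symbols occurring in a term. -/
def funs : Term S V → Set S.symbol
  | var _ => ∅
  | app f ts => {f} ∪ ⋃ i, (ts i).funs

/-- Application of a substitution. -/
def subst {W : Type w} (σ : V → Term S W) : Term S V → Term S W
  | var x => σ x
  | app f ts => app f fun i => (ts i).subst σ

/-- `SubtermAt s p t`: `p` is a position of `s` and `t` is the subterm of `s` at `p`
(arguments are numbered from `0`). -/
def SubtermAt : Term S V → List ℕ → Term S V → Prop
  | s, [], t => s = t
  | .var _, _ :: _, _ => False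
  | .app f ts, i :: p, t => ∃ h : i < S.arity f, SubtermAt (ts ⟨i, h⟩) p t

/-- `t` is a subterm of `s`. -/
def HasSubterm (s t : Term S V) : Prop := ∃ p, SubtermAt s p t

/-- `t` is a proper subterm of `s`. -/
def HasProperSubterm (s t : Term S V) : Prop := ∃ p, p ≠ [] ∧ SubtermAt s p t

end Term

/-- A rewrite rule `lhs → rhs`. -/
structure Rule (S : Signature.{u}) (V : Type v) where
  lhs : Term S V
  rhs : Term S V

section Rewrite

variable {S : Signature.{u}} {V : Type v}

/-- A term rewrite system: finitely many rules, no left-hand side is a variable, and every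
variable of a right-hand side occurs in the left-hand side. -/
structure IsTRS (R : Set (Rule S V)) : Prop where
  finite : R.Finite
  lhs_ne_var : ∀ ρ ∈ R, ∀ x, ρ.lhs ≠ Term.var x
  vars_subset : ∀ ρ ∈ R, ρ.rhs.vars ⊆ ρ.lhs.vars

/-- The rewrite relation of `R`. -/
inductive Step (R : Set (Rule S V)) : Term S V → Term S V → Prop
  | root (ρ : Rule S V) (hρ : ρ ∈ R) (σ : V → Term S V) :
      Step R (ρ.lhs.subst σ) (ρ.rhs.subst σ)
  | arg (f : S.symbol) (ts : Fin (S.arity f) → Term S V) (i : Fin (S.arity f))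
      (u : Term S V) : Step R (ts i) u → Step R (.app f ts) (.app f (Function.update ts i u))

/-- Normal forms of `R`. -/
def NF (R : Set (Rule S V)) : Set (Term S V) := {t | ∀ u, ¬ Step R t u}

/-- The innermost rewrite relation of `R`: all proper subterms of the redex are normal forms. -/
inductive InnermostStep (R : Set (Rule S V)) : Term S V → Term S V → Prop
  | root (ρ : Rule S V) (hρ : ρ ∈ R) (σ : V → Term S V)
      (h : ∀ u, (ρ.lhs.subst σ).HasProperSubterm u → u ∈ NF R) :
      InnermostStep R (ρ.lhs.subst σ) (ρ.rhs.subst σ)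
  | arg (f : S.symbol) (ts : Fin (S.arity f) → Term S V) (i : Fin (S.arity f))
      (u : Term S V) : InnermostStep R (ts i) u →
      InnermostStep R (.app f ts) (.app f (Function.update ts i u))

/-- The relative rewrite relation of `R` over `Q`. -/
def RelativeStep (R Q : Set (Rule S V)) (s t : Term S V) : Prop :=
  ∃ s' t', Relation.ReflTransGen (Step Q) s s' ∧ Step R s' t' ∧
    Relation.ReflTransGen (Step Q) t' t

/-- Defined symbols: the roots of left-hand sides. All other symbols are constructors. -/
def defined (R : Set (Rule S V)) : Set S.symbol := {f | ∃ ρ ∈ R, ∃ ts, ρ.lhs = .app f ts}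

/-- Basic terms: a defined symbol applied to terms built from constructors and variables. -/
def basicTerms (R : Set (Rule S V)) : Set (Term S V) :=
  {t | ∃ f ts, t = .app f ts ∧ f ∈ defined R ∧ ∀ i, Disjoint (ts i).funs (defined R)}

/-! ### Runtime complexity -/

/-- Full or innermost rewriting. -/
inductive Strategy
  | full
  | innermost

/-- The rewrite relation of `R` under the given strategy. -/
def Strategy.step : Strategy → Set (Rule S V) → Term S V → Term S V → Prop
  | .full, R => Step R
  | .innermost, R => InnermostStep R

end Rewrite

/-- `Steps r n s t`: there are exactly `n` `r`-steps from `s` to `t`. -/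
inductive Steps {α : Type*} (r : α → α → Prop) : ℕ → α → α → Prop
  | zero (s : α) : Steps r 0 s s
  | succ (n : ℕ) (s t u : α) : r s t → Steps r n t u → Steps r (n + 1) s u

/-- Derivation height, with value `⊤` if there are arbitrarily long derivations. -/
noncomputable def dheight {α : Type*} (r : α → α → Prop) (s : α) : ℕ∞ :=
  ⨆ (n : ℕ) (_ : ∃ t, Steps r n s t), (n : ℕ∞)

section Complexity

variable {S : Signature.{u}} {V : Type v}

/-- The complexity function of `r` on the set `T` of start terms. -/
noncomputable def comp (n : ℕ) (T : Set (Term S V)) (r : Term S V → Term S V → Prop) : ℕ∞ :=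
  ⨆ (t : Term S V) (_ : t ∈ T ∧ t.size ≤ n), dheight r t

/-- The runtime complexity function of `R` for full, respectively innermost, rewriting. -/
noncomputable def runtimeComplexity (st : Strategy) (R : Set (Rule S V)) (n : ℕ) : ℕ∞ :=
  comp n (basicTerms R) (st.step R)

/-! ### Usable replacement maps -/

variable (S) in
/-- A replacement map: a set of argument positions for each symbol. -/
abbrev ReplacementMap := ∀ f : S.symbol, Set (Fin (S.arity f))

/-- `MuPos μ t p`: the position `p` of `t` is `μ`-replacing. -/
def MuPos (μ : ReplacementMap S) : Term S V → List ℕ → Prop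
  | _, [] => True
  | .var _, _ :: _ => False
  | .app f ts, i :: p => ∃ h : i < S.arity f, ⟨i, h⟩ ∈ μ f ∧ MuPos μ (ts ⟨i, h⟩) p

/-- `t` is the subterm of `s` at some non-`μ`-replacing position of `s`. -/
def OccursFrozen (μ : ReplacementMap S) (s t : Term S V) : Prop :=
  ∃ p, Term.SubtermAt s p t ∧ ¬ MuPos μ s p

/-- Unifiability of `t` with `l` after renaming their variables apart (hence the two
independent substitutions). -/
def Unifiable {W : Type w} (t : Term S W) (l : Term S V) : Prop :=
  ∃ (σ : W → Term S V) (τ : V → Term S V), t.subst σ = l.subst τ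

/-- The embedding of terms over `V` into terms that may also contain fresh variables; the fresh
variables are indexed by positions, so that distinct replaced occurrences get distinct ones. -/
def Term.old : Term S V → Term S (V ⊕ List ℕ) := Term.subst fun x => .var (.inl x)

/-- The function `CAP` for `μ`, `R` and `s`. The argument `p` is the position of the current
subterm in the term the recursion started from; it names the fresh variable. -/
noncomputable def cap (R : Set (Rule S V)) (μ : ReplacementMap S) (s : Term S V) :
    List ℕ → Term S V → Term S (V ⊕ List ℕ)
  | p, .var x => if OccursFrozen μ s (.var x) then .var (.inl x) else .var (.inr p)
  | p, .app f ts =>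
      if OccursFrozen μ s (.app f ts) then (Term.app f ts).old
      else if ∃ ρ ∈ R, Unifiable (.app f fun i => cap R μ s (p ++ [i.val]) (ts i)) ρ.lhs
        then .var (.inr p)
        else .app f fun i => cap R μ s (p ++ [i.val]) (ts i)

/-- The operator `Υ`: the argument positions `i` of `f` such that some right-hand side has a
subterm `f(r₁,…,rₙ)` with `CAP(rᵢ) ≠ rᵢ`. -/
def upsilon (R : Set (Rule S V)) (μ : ReplacementMap S) : ReplacementMap S := fun f =>
  {i | ∃ ρ ∈ R, ∃ ts, ρ.rhs.HasSubterm (.app f ts) ∧ cap R μ ρ.lhs [] (ts i) ≠ (ts i).old}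

theorem MuPos.mono {μ ν : ReplacementMap S} (h : μ ≤ ν) :
    ∀ {t : Term S V} {p : List ℕ}, MuPos μ t p → MuPos ν t p
  | _, [], _ => by simp [MuPos]
  | .var _, _ :: _, hp => by simp [MuPos] at hp
  | .app f _, _ :: _, hp => by
    rw [MuPos] at hp ⊢
    obtain ⟨h1, h2, h3⟩ := hp
    exact ⟨h1, h f h2, h3.mono h⟩

theorem cap_eq_of_le {R : Set (Rule S V)} {μ ν : ReplacementMap S} (h : μ ≤ ν) (s : Term S V)
    (t : Term S V) : ∀ p, cap R ν s p t = t.old → cap R μ s p t = t.old := by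
  have hf : ∀ t : Term S V, OccursFrozen ν s t → OccursFrozen μ s t :=
    fun t ⟨p, h1, h2⟩ => ⟨p, h1, fun h3 => h2 (h3.mono h)⟩
  induction t with
  | var x =>
    intro p hp
    by_cases h1 : OccursFrozen μ s (.var x)
    · simp [cap, h1, Term.old, Term.subst]
    · have h2 : ¬ OccursFrozen ν s (.var x) := fun h3 => h1 (hf _ h3)
      simp [cap, h2, Term.old, Term.subst] at hp
  | app f ts ih =>
    intro p hp
    by_cases h1 : OccursFrozen μ s (.app f ts)
    · simp [cap, h1]
    · have h2 : ¬ OccursFrozen ν s (.app f ts) := fun h3 => h1 (hf _ h3)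
      rw [cap, if_neg h2] at hp
      split_ifs at hp with h3
      · simp [Term.old, Term.subst] at hp
      · have hp' : ∀ i, cap R ν s (p ++ [i.val]) (ts i) = (ts i).old := by
          simp only [Term.old, Term.subst, Term.app.injEq, heq_eq_eq, true_and] at hp
          exact fun i => congrFun hp i
        have e : (fun i : Fin (S.arity f) => cap R μ s (p ++ [i.val]) (ts i)) =
            fun i => cap R ν s (p ++ [i.val]) (ts i) :=
          funext fun i => (ih i _ (hp' i)).trans (hp' i).symm
        rw [cap, if_neg h1, e, if_neg h3, hp]

theorem upsilon_mono (R : Set (Rule S V)) : Monotone (upsilon R) := by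
  rintro μ ν h f i ⟨ρ, hρ, ts, h1, h2⟩
  exact ⟨ρ, hρ, ts, h1, fun h3 => h2 (cap_eq_of_le h _ _ _ h3)⟩

/-- The usable replacement map of `R` (the least fixed point of `Υ`), respectively its innermost
usable replacement map (`Υ(∅)`). -/
noncomputable def Strategy.usableMap : Strategy → Set (Rule S V) → ReplacementMap S
  | .full, R => OrderHom.lfp ⟨upsilon R, upsilon_mono R⟩
  | .innermost, R => upsilon R ⊥

/-! ### Usable rules -/

/-- `f` depends on `g`: some rule has root `f` on the left and the defined symbol `g` on the
right. -/
def Depends (R : Set (Rule S V)) (f g : S.symbol) : Prop :=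
  ∃ ρ ∈ R, (∃ ts, ρ.lhs = .app f ts) ∧ g ∈ defined R ∧ g ∈ ρ.rhs.funs

/-- The usable rules of a term. -/
def usableRulesOf (R : Set (Rule S V)) (t : Term S V) : Set (Rule S V) :=
  {ρ | ρ ∈ R ∧ ∃ g, (∃ ts, ρ.lhs = .app g ts) ∧
    ∃ f ∈ t.funs, Relation.ReflTransGen (Depends R) f g}

end Complexity

/-! ### Weak (innermost) dependency pairs -/

/-- The extended symbols: those of `S`, a dependency pair symbol `f♯` for each `f`, and for each
rule its own fresh compound symbols, one of each arity `n`. -/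
inductive DPSymbol (S : Signature.{u}) (V : Type v) : Type (max u v)
  | base (f : S.symbol)
  | sharp (f : S.symbol)
  | com (ρ : Rule S V) (n : ℕ)

/-- The signature of the extended symbols. -/
abbrev dpSignature (S : Signature.{u}) (V : Type v) : Signature.{max u v} where
  symbol := DPSymbol S V
  arity
    | .base f => S.arity f
    | .sharp f => S.arity f
    | .com _ n => n

section DP

variable {S : Signature.{u}} {V : Type v}

/-- A term over `S` regarded as a term over the extended signature. -/
def Term.lift : Term S V → Term (dpSignature S V) V
  | .var x => .var x
  | .app f ts => .app (S := dpSignature S V) (.base f) fun i => (ts i).lift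

/-- The operation `t ↦ t♯` of marking the root symbol. -/
def Term.sharp : Term S V → Term (dpSignature S V) V
  | .var x => .var x
  | .app f ts => .app (S := dpSignature S V) (.sharp f) fun i => (ts i).lift

/-- The rules of `R` regarded as rules over the extended signature. -/
def liftRules (R : Set (Rule S V)) : Set (Rule (dpSignature S V) V) :=
  (fun ρ => ⟨ρ.lhs.lift, ρ.rhs.lift⟩) '' R

/-- The list `u₁, …, uₙ` for which `t = C⟨u₁, …, uₙ⟩_X`, from left to right: the outermost
subterms with root in `X`. Here `X` is `D` together with the variables for full rewriting, and
`D` for innermost rewriting. -/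
noncomputable def outermost (st : Strategy) (D : Set S.symbol) : Term S V → List (Term S V)
  | .var x => match st with
    | .full => [.var x]
    | .innermost => []
  | .app f ts => if f ∈ D then [.app f ts]
      else (List.ofFn fun i => outermost st D (ts i)).flatten

/-- `COM(u₁, …, uₙ)`: the term `u₁` if `n = 1`, and otherwise the compound symbol of `ρ` of
arity `n` applied to `u₁, …, uₙ`. -/
def compound (ρ : Rule S V) : List (Term (dpSignature S V) V) → Term (dpSignature S V) V
  | [u] => u
  | us => .app (S := dpSignature S V) (.com ρ us.length) us.get

/-- The weak dependency pair, respectively the weak innermost dependency pair, of a rule. -/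
noncomputable def dependencyPair (st : Strategy) (R : Set (Rule S V)) (ρ : Rule S V) :
    Rule (dpSignature S V) V where
  lhs := ρ.lhs.sharp
  rhs := compound ρ ((outermost st (defined R) ρ.rhs).map Term.sharp)

/-- The set of weak dependency pairs, respectively of weak innermost dependency pairs. -/
def dependencyPairs (st : Strategy) (R : Set (Rule S V)) : Set (Rule (dpSignature S V) V) :=
  dependencyPair st R '' R

/-- The usable rules of a set `P` of dependency pairs of `R`. -/
def usableRules (R : Set (Rule S V)) (P : Set (Rule (dpSignature S V) V)) :
    Set (Rule (dpSignature S V) V) :=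
  ⋃ π ∈ P, usableRulesOf (liftRules R) π.rhs

/-- The (innermost) usable replacement map of the dependency pairs and their usable rules. -/
noncomputable def dpUsableMap (st : Strategy) (R : Set (Rule S V)) :
    ReplacementMap (dpSignature S V) :=
  st.usableMap (dependencyPairs st R ∪ usableRules R (dependencyPairs st R))

end DP

/-! ### Matrix interpretations -/

/-- A matrix interpretation of dimension `d`: the symbol `f` is interpreted as
`(v₁, …, vₙ) ↦ F₁ v₁ + ⋯ + Fₙ vₙ + f`, over the natural numbers. -/
structure MatrixInterp (S : Signature.{u}) (d : ℕ) where
  mat : ∀ f : S.symbol, Fin (S.arity f) → Matrix (Fin d) (Fin d) ℕ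
  vec : S.symbol → Fin d → ℕ

/-- The strict order on vectors. -/
def VecGT {d : ℕ} [NeZero d] (x y : Fin d → ℕ) : Prop := y 0 < x 0 ∧ ∀ j, y j ≤ x j

/-- Upper triangular complexity matrices. -/
def IsUpperTriangularComplexity {d : ℕ} (M : Matrix (Fin d) (Fin d) ℕ) : Prop :=
  (∀ j k, k < j → M j k = 0) ∧ ∀ j, M j j ≤ 1

namespace MatrixInterp

variable {S : Signature.{u}} {V : Type v} {d : ℕ}

/-- The interpretation function of a symbol. -/
def interp (A : MatrixInterp S d) (f : S.symbol) (x : Fin (S.arity f) → Fin d → ℕ) :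
    Fin d → ℕ :=
  ∑ i, A.mat f i *ᵥ x i + A.vec f

/-- Evaluation of terms under an assignment. -/
def eval (A : MatrixInterp S d) (α : V → Fin d → ℕ) : Term S V → Fin d → ℕ
  | .var x => α x
  | .app f ts => A.interp f fun i => A.eval α (ts i)

/-- The strict order induced on terms. -/
def TermGT [NeZero d] (A : MatrixInterp S d) (s t : Term S V) : Prop :=
  ∀ α : V → Fin d → ℕ, VecGT (A.eval α s) (A.eval α t)

/-- The quasi-order induced on terms by the componentwise order on vectors. -/
def TermGE (A : MatrixInterp S d) (s t : Term S V) : Prop :=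
  ∀ α : V → Fin d → ℕ, A.eval α t ≤ A.eval α s

/-- Strict monotonicity of every `f` on the argument positions in `μ(f)`. -/
def IsMuMonotone [NeZero d] (A : MatrixInterp S d) (μ : ReplacementMap S) : Prop :=
  ∀ f, ∀ i ∈ μ f, ∀ (z : Fin (S.arity f) → Fin d → ℕ) (x y : Fin d → ℕ), VecGT x y →
    VecGT (A.interp f (Function.update z i x)) (A.interp f (Function.update z i y))

/-- A restricted matrix interpretation (over the extended signature): all constructors of `R` are
interpreted with upper triangular complexity matrices. -/
def IsRMI (A : MatrixInterp (dpSignature S V) d) (R : Set (Rule S V)) : Prop :=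
  ∀ f, f ∉ defined R → ∀ i, IsUpperTriangularComplexity (A.mat (.base f) i)

/-- All compound symbols have a strongly linear interpretation: the only matrix is the unit
matrix (which makes them strictly monotone in every argument). -/
def IsAdequate (A : MatrixInterp (dpSignature S V) d) : Prop :=
  ∀ (ρ : Rule S V) (n : ℕ) (i : Fin n), A.mat (.com ρ n) i = 1

/-- The weight gap is well-defined: the natural numbers `[α](r)₁ ∸ [α](l)₁`, where `l → r` ranges
over `P` and `α` over all assignments, are bounded. -/
def HasWeightGap [NeZero d] (A : MatrixInterp S d) (P : Set (Rule S V)) : Prop :=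
  BddAbove {k : ℕ | ∃ π ∈ P, ∃ α : V → Fin d → ℕ, k = A.eval α π.rhs 0 - A.eval α π.lhs 0}

/-- `A` is of basic degree `k`: under the zero assignment, the values of the terms `t♯`, with `t`
basic, are at most `c · |t♯| ^ k`. -/
def IsOfBasicDegree (A : MatrixInterp (dpSignature S V) d) (R : Set (Rule S V)) (k : ℕ) : Prop :=
  ∃ c : ℕ, ∀ t ∈ basicTerms R, ∀ j, A.eval 0 t.sharp j ≤ c * t.sharp.size ^ k

/-- The number of ones on the diagonal of the componentwise maximum of the matrices used for the
constructors of `R`. (For an RMI the diagonal entries are at most one.) -/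
noncomputable def diagonalOnes (A : MatrixInterp (dpSignature S V) d) (R : Set (Rule S V)) : ℕ :=
  Set.ncard {j : Fin d | ∃ f, f ∉ defined R ∧ ∃ i, A.mat (.base f) i j j = 1}

end MatrixInterp

section ComplexityPair

variable {S : Signature.{u}} {V : Type v}

/-- A binary relation on terms is monotone in the argument `i` of `f`. -/
def MonotoneInArg (r : Term S V → Term S V → Prop) (f : S.symbol) (i : Fin (S.arity f)) : Prop :=
  ∀ (ts : Fin (S.arity f) → Term S V) (s t : Term S V), r s t →
    r (.app f (Function.update ts i s)) (.app f (Function.update ts i t))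

/-- `gt` is collapsible on `r`. -/
def IsCollapsibleOn (gt r : Term S V → Term S V → Prop) : Prop :=
  ∃ G : Term S V → ℕ, ∀ s t, r s t → gt s t → G t < G s

/-- `(ge, gt)` is a `μ`-complexity pair for the relative system `P/Q`. -/
structure IsComplexityPair (μ : ReplacementMap (dpSignature S V))
    (P Q : Set (Rule (dpSignature S V) V))
    (ge gt : Term (dpSignature S V) V → Term (dpSignature S V) V → Prop) : Prop where
  ge_refl : ∀ s, ge s s
  ge_trans : ∀ s t u, ge s t → ge t u → ge s u
  ge_monotone : ∀ f, ∀ i ∈ μ f, MonotoneInArg ge f i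
  gt_irrefl : ∀ s, ¬ gt s s
  gt_trans : ∀ s t u, gt s t → gt t u → gt s u
  compatible : (∀ s t u, ge s t → gt t u → gt s u) ∨ (∀ s t u, gt s t → ge t u → gt s u)
  collapsible : IsCollapsibleOn gt (RelativeStep P Q)
  gt_monotone : ∀ (ρ : Rule S V) (n : ℕ) (i : Fin n), i ∈ μ (.com ρ n) →
    MonotoneInArg (S := dpSignature S V) gt (.com ρ n) i

/-- The relation `r` orients all rules of `Q`. -/
def Orients (r : Term S V → Term S V → Prop) (Q : Set (Rule S V)) : Prop :=
  ∀ π ∈ Q, r π.lhs π.rhs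

end ComplexityPair

end Rewriting

open Rewriting

/-! Every `R`-derivation from a basic term `s` is simulated, step for step, by a derivation from
`s♯` with the dependency pairs and their usable rules, and the length of the latter is bounded by a
weight. While `s` is rewritten, its redexes stay inside disjoint subterms, each of which is tracked
as a leaf below a tree of compound symbols (`Covers`, `CompoundTree`). A step inside `s` is either a
usable-rule step in one leaf, or a root step of a marked leaf, which becomes a dependency pair step
and replaces that leaf by the leaves of the right-hand side (`Covers.step`). The order of leaves is
irrelevant, hence multisets.

The interpretations are strictly monotone only at `μ`-replacing positions, so the simulated steps
must occur there. The invariant `FrozenNormal` says that whatever lies at a non-replacing position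
is in normal form. It holds for `s♯`, and `FrozenNormal.step` shows that it is preserved: this is
exactly what the definition of the usable replacement map provides.

With the first components `wA`, `wB` of the values under the two interpretations, a usable-rule step
decreases `wA` and does not increase `wB`, while a dependency pair step decreases `wB` and increases
`wA` by at most the weight gap `Δ`. So `wA + (Δ + 1) * wB` decreases in each step and bounds the
length (`length_le_of_weights`).

For the degree, upper triangular matrices let the components of constructor terms be bounded from
the last index to the first, where only a diagonal one raises the exponent (`exists_eval_lift_le`).
The signature may be infinite and its constructors need not have bounded matrices. Therefore weights
are taken after `Term.strip`, which erases subterms whose root is an unmarked symbol foreign to `R`;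
such symbols occur in no rule, so stripping is compatible with rewriting. -/

namespace Rewriting

open Classical Matrix

/-! ### Subterms, symbols and sizes -/

section Terms

variable {S : Signature.{u}} {V : Type v} {W : Type w}

theorem Term.subtermAt_subst (σ : V → Term S W) :
    ∀ {s : Term S V} {p : List ℕ} {t : Term S V},
      s.SubtermAt p t → (s.subst σ).SubtermAt p (t.subst σ)
  | s, [], t, h => by
    rw [Term.SubtermAt] at h ⊢
    rw [h]
  | .var _, _ :: _, _, h => by simp [Term.SubtermAt] at h
  | .app f ts, i :: p, t, h => by
    rw [Term.SubtermAt] at h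
    obtain ⟨hi, h⟩ := h
    rw [Term.subst, Term.SubtermAt]
    exact ⟨hi, Term.subtermAt_subst σ h⟩

theorem Term.hasSubterm_refl (s : Term S V) : s.HasSubterm s := ⟨[], by rw [Term.SubtermAt]⟩

theorem Term.HasSubterm.of_arg {f : S.symbol} {ts : Fin (S.arity f) → Term S V}
    {i : Fin (S.arity f)} {t : Term S V} (h : (ts i).HasSubterm t) :
    (Term.app f ts).HasSubterm t := by
  obtain ⟨p, hp⟩ := h
  exact ⟨i.val :: p, by rw [Term.SubtermAt]; exact ⟨i.2, hp⟩⟩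

theorem Term.subtermAt_arg {f : S.symbol} {ts : Fin (S.arity f) → Term S V}
    (i : Fin (S.arity f)) : ∀ {s : Term S V} {p : List ℕ},
      s.SubtermAt p (.app f ts) → s.SubtermAt (p ++ [i.val]) (ts i)
  | s, [], h => by
    rw [Term.SubtermAt] at h
    subst h
    simp [Term.SubtermAt]
  | .var _, _ :: _, h => by simp [Term.SubtermAt] at h
  | .app g us, j :: p, h => by
    rw [Term.SubtermAt] at h
    obtain ⟨hj, h⟩ := h
    rw [List.cons_append, Term.SubtermAt]
    exact ⟨hj, Term.subtermAt_arg i h⟩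

theorem Term.HasSubterm.arg {s : Term S V} {f : S.symbol} {ts : Fin (S.arity f) → Term S V}
    (h : s.HasSubterm (.app f ts)) (i : Fin (S.arity f)) : s.HasSubterm (ts i) := by
  obtain ⟨p, hp⟩ := h
  exact ⟨_, Term.subtermAt_arg i hp⟩

theorem Term.hasSubterm_var {x : V} : ∀ {s : Term S V}, x ∈ s.vars → s.HasSubterm (.var x)
  | .var y, h => by
    rw [Term.vars, Set.mem_singleton_iff] at h
    subst h
    exact Term.hasSubterm_refl _
  | .app f ts, h => by
    rw [Term.vars, Set.mem_iUnion] at h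
    obtain ⟨i, hi⟩ := h
    exact (Term.hasSubterm_var hi).of_arg

theorem Term.hasProperSubterm_arg (f : S.symbol) (ts : Fin (S.arity f) → Term S V)
    (i : Fin (S.arity f)) {t : Term S V} (h : (ts i).HasSubterm t) :
    (Term.app f ts).HasProperSubterm t := by
  obtain ⟨p, hp⟩ := h
  exact ⟨i.val :: p, by simp, by rw [Term.SubtermAt]; exact ⟨i.2, hp⟩⟩

theorem Term.exists_hasSubterm_arg_of_hasProperSubterm {f : S.symbol}
    {ts : Fin (S.arity f) → Term S V} {t : Term S V} (h : (Term.app f ts).HasProperSubterm t) :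
    ∃ i, (ts i).HasSubterm t := by
  obtain ⟨p, hp, h⟩ := h
  cases p with
  | nil => exact absurd rfl hp
  | cons i p =>
    rw [Term.SubtermAt] at h
    obtain ⟨hi, h⟩ := h
    exact ⟨⟨i, hi⟩, p, h⟩

theorem Term.HasSubterm.funs_subset {t : Term S V} : ∀ {s : Term S V}, s.HasSubterm t →
    t.funs ⊆ s.funs := by
  have key : ∀ (p : List ℕ) (s : Term S V), s.SubtermAt p t → t.funs ⊆ s.funs := by
    intro p
    induction p with
    | nil =>
      intro s h
      rw [Term.SubtermAt] at h
      rw [h]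
    | cons i p ih =>
      intro s h
      cases s with
      | var x => simp [Term.SubtermAt] at h
      | app f ts =>
        rw [Term.SubtermAt] at h
        obtain ⟨hi, h⟩ := h
        rw [Term.funs]
        exact fun g hg => Or.inr (Set.mem_iUnion.2 ⟨_, ih _ h hg⟩)
  rintro s ⟨p, h⟩
  exact key p s h

theorem Term.HasSubterm.vars_subset {t : Term S V} : ∀ {s : Term S V}, s.HasSubterm t →
    t.vars ⊆ s.vars := by
  have key : ∀ (p : List ℕ) (s : Term S V), s.SubtermAt p t → t.vars ⊆ s.vars := by
    intro p
    induction p with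
    | nil =>
      intro s h
      rw [Term.SubtermAt] at h
      rw [h]
    | cons i p ih =>
      intro s h
      cases s with
      | var x => simp [Term.SubtermAt] at h
      | app f ts =>
        rw [Term.SubtermAt] at h
        obtain ⟨hi, h⟩ := h
        rw [Term.vars]
        exact fun g hg => Set.mem_iUnion.2 ⟨_, ih _ h hg⟩
  rintro s ⟨p, h⟩
  exact key p s h

theorem Term.funs_subst {σ : V → Term S W} {g : S.symbol} : ∀ {t : Term S V},
    g ∈ (t.subst σ).funs → g ∈ t.funs ∨ ∃ x ∈ t.vars, g ∈ (σ x).funs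
  | .var x, h => Or.inr ⟨x, by rw [Term.vars]; rfl, h⟩
  | .app f ts, h => by
    rw [Term.subst, Term.funs] at h
    rw [Term.funs, Term.vars]
    rcases h with h | h
    · exact Or.inl (Or.inl h)
    · obtain ⟨i, hi⟩ := Set.mem_iUnion.1 h
      rcases Term.funs_subst hi with h | ⟨x, hx, h⟩
      · exact Or.inl (Or.inr (Set.mem_iUnion.2 ⟨i, h⟩))
      · exact Or.inr ⟨x, Set.mem_iUnion.2 ⟨i, hx⟩, h⟩

theorem Term.funs_finite : ∀ t : Term S V, t.funs.Finite
  | .var _ => by rw [Term.funs]; exact Set.finite_empty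
  | .app f ts => by
    rw [Term.funs]
    exact (Set.finite_singleton f).union (Set.finite_iUnion fun i => (ts i).funs_finite)

theorem Term.size_pos : ∀ t : Term S V, 0 < t.size
  | .var _ => by simp [Term.size]
  | .app f ts => by rw [Term.size]; omega

theorem Term.size_arg_le (f : S.symbol) (ts : Fin (S.arity f) → Term S V) (i : Fin (S.arity f)) :
    (ts i).size ≤ (Term.app f ts).size := by
  rw [Term.size]
  exact (Finset.single_le_sum (f := fun i => (ts i).size) (fun _ _ => Nat.zero_le _)
    (Finset.mem_univ i)).trans (Nat.le_add_left _ _)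

end Terms

/-! ### Rewrite steps under both strategies -/

section Steps

variable {S : Signature.{u}} {V : Type v}

/-- One case analysis that serves full and innermost rewriting at once; the strategies differ only
in the side condition on root steps. -/
theorem Strategy.step_iff {st : Strategy} {R : Set (Rule S V)} {s t : Term S V} :
    st.step R s t ↔
      (∃ ρ ∈ R, ∃ σ : V → Term S V, s = ρ.lhs.subst σ ∧ t = ρ.rhs.subst σ ∧
        (st = .innermost → ∀ u, s.HasProperSubterm u → u ∈ NF R)) ∨
      (∃ f ts i u, s = .app f ts ∧ st.step R (ts i) u ∧ t = .app f (Function.update ts i u)) := by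
  cases st with
  | full =>
    constructor
    · intro h
      cases h with
      | root ρ hρ σ => exact Or.inl ⟨ρ, hρ, σ, rfl, rfl, by simp⟩
      | arg f ts i u h => exact Or.inr ⟨f, ts, i, u, rfl, h, rfl⟩
    · rintro (⟨ρ, hρ, σ, rfl, rfl, -⟩ | ⟨f, ts, i, u, rfl, h, rfl⟩)
      · exact Step.root ρ hρ σ
      · exact Step.arg f ts i u h
  | innermost =>
    constructor
    · intro h
      cases h with
      | root ρ hρ σ h => exact Or.inl ⟨ρ, hρ, σ, rfl, rfl, fun _ => h⟩
      | arg f ts i u h => exact Or.inr ⟨f, ts, i, u, rfl, h, rfl⟩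
    · rintro (⟨ρ, hρ, σ, rfl, rfl, h⟩ | ⟨f, ts, i, u, rfl, h, rfl⟩)
      · exact InnermostStep.root ρ hρ σ (h rfl)
      · exact InnermostStep.arg f ts i u h

theorem Strategy.step_arg {st : Strategy} {R : Set (Rule S V)} (f : S.symbol)
    (ts : Fin (S.arity f) → Term S V) (i : Fin (S.arity f)) {u : Term S V}
    (h : st.step R (ts i) u) : st.step R (.app f ts) (.app f (Function.update ts i u)) :=
  Strategy.step_iff.2 (Or.inr ⟨f, ts, i, u, rfl, h, rfl⟩)

theorem Strategy.step_toStep {st : Strategy} {R : Set (Rule S V)} {s t : Term S V}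
    (h : st.step R s t) : Step R s t := by
  cases st with
  | full => exact h
  | innermost =>
    change InnermostStep R s t at h
    induction h with
    | root ρ hρ σ _ => exact Step.root ρ hρ σ
    | arg f ts i u _ ih => exact Step.arg f ts i u ih

theorem NF.arg {R : Set (Rule S V)} {f : S.symbol} {ts : Fin (S.arity f) → Term S V}
    (h : Term.app f ts ∈ NF R) (i : Fin (S.arity f)) : ts i ∈ NF R :=
  fun u hu => h _ (Step.arg f ts i u hu)

theorem NF.subtermAt {R : Set (Rule S V)} {t : Term S V} : ∀ {s : Term S V} {p : List ℕ},
    s ∈ NF R → s.SubtermAt p t → t ∈ NF R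
  | s, [], hs, h => by
    rw [Term.SubtermAt] at h
    exact h ▸ hs
  | .var _, _ :: _, _, h => by simp [Term.SubtermAt] at h
  | .app f ts, i :: p, hs, h => by
    rw [Term.SubtermAt] at h
    obtain ⟨hi, h⟩ := h
    exact NF.subtermAt (NF.arg hs ⟨i, hi⟩) h

/-! ### Terms whose frozen subterms are normal forms -/

/-- All subterms at non-`μ`-replacing positions are normal forms of `R`. -/
inductive FrozenNormal (μ : ReplacementMap S) (R : Set (Rule S V)) : Term S V → Prop
  | var (x : V) : FrozenNormal μ R (.var x)
  | app (f : S.symbol) (ts : Fin (S.arity f) → Term S V) :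
      (∀ i ∈ μ f, FrozenNormal μ R (ts i)) → (∀ i, i ∉ μ f → ts i ∈ NF R) →
      FrozenNormal μ R (.app f ts)

variable {μ μ₀ : ReplacementMap S} {R : Set (Rule S V)}

theorem FrozenNormal.of_mem_NF : ∀ {t : Term S V}, t ∈ NF R → FrozenNormal μ R t
  | .var x, _ => .var x
  | .app f ts, h =>
    .app f ts (fun i _ => FrozenNormal.of_mem_NF (NF.arg h i)) fun i _ => NF.arg h i

theorem FrozenNormal.of_arg {f : S.symbol} {ts : Fin (S.arity f) → Term S V}
    (h : FrozenNormal μ R (.app f ts)) (i : Fin (S.arity f)) : FrozenNormal μ R (ts i) := by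
  cases h with
  | app _ _ h1 h2 =>
    by_cases hi : i ∈ μ f
    · exact h1 i hi
    · exact .of_mem_NF (h2 i hi)

/-- This is how the invariant is used: a reducible argument cannot be frozen, so strict monotonicity
is available wherever a step takes place. -/
theorem FrozenNormal.mem_map {f : S.symbol} {ts : Fin (S.arity f) → Term S V}
    (h : FrozenNormal μ R (.app f ts)) {i : Fin (S.arity f)} {u : Term S V}
    (hu : Step R (ts i) u) : i ∈ μ f := by
  cases h with
  | app _ _ _ h2 =>
    by_contra hi
    exact h2 i hi u hu

theorem FrozenNormal.update {f : S.symbol} {ts : Fin (S.arity f) → Term S V}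
    (h : FrozenNormal μ R (.app f ts)) {i : Fin (S.arity f)} (hi : i ∈ μ f) {u : Term S V}
    (hu : FrozenNormal μ R u) : FrozenNormal μ R (.app f (Function.update ts i u)) := by
  cases h with
  | app _ _ h1 h2 =>
    refine .app _ _ (fun j hj => ?_) fun j hj => ?_
    · rcases eq_or_ne j i with rfl | hne
      · simpa using hu
      · rw [Function.update_of_ne hne]; exact h1 j hj
    · have hne : j ≠ i := fun e => hj (e ▸ hi)
      rw [Function.update_of_ne hne]; exact h2 j hj

theorem FrozenNormal.subtermAt {t : Term S V} : ∀ {s : Term S V} {p : List ℕ},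
    FrozenNormal μ R s → s.SubtermAt p t → FrozenNormal μ R t
  | s, [], hs, h => by
    rw [Term.SubtermAt] at h
    exact h ▸ hs
  | .var _, _ :: _, _, h => by simp [Term.SubtermAt] at h
  | .app f ts, i :: p, hs, h => by
    rw [Term.SubtermAt] at h
    obtain ⟨hi, h⟩ := h
    exact FrozenNormal.subtermAt (hs.of_arg ⟨i, hi⟩) h

theorem FrozenNormal.subst_mem_NF {σ : V → Term S V} {t : Term S V} :
    ∀ {s : Term S V} {p : List ℕ}, FrozenNormal μ R (s.subst σ) → s.SubtermAt p t →
      ¬ MuPos μ s p → t.subst σ ∈ NF R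
  | s, [], _, _, hp => absurd (by simp [MuPos]) hp
  | .var _, _ :: _, _, h, _ => by simp [Term.SubtermAt] at h
  | .app f ts, i :: p, hs, h, hp => by
    rw [Term.SubtermAt] at h
    obtain ⟨hi, h⟩ := h
    rw [Term.subst] at hs
    by_cases hμ : (⟨i, hi⟩ : Fin (S.arity f)) ∈ μ f
    · refine FrozenNormal.subst_mem_NF (hs.of_arg ⟨i, hi⟩) h fun hp' => hp ?_
      rw [MuPos]
      exact ⟨hi, hμ, hp'⟩
    · cases hs with
      | app _ _ _ h2 => exact NF.subtermAt (h2 _ hμ) (Term.subtermAt_subst σ h)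

/-- Instances of terms which `cap` leaves unchanged are normal forms. -/
theorem subst_mem_NF_of_cap_eq {l : Term S V} {σ : V → Term S V}
    (hl : ∀ t, OccursFrozen μ₀ l t → t.subst σ ∈ NF R) :
    ∀ (t : Term S V) (p : List ℕ), cap R μ₀ l p t = t.old → t.subst σ ∈ NF R := by
  intro t
  induction t with
  | var x =>
    intro p hp
    by_cases h : OccursFrozen μ₀ l (.var x)
    · exact hl _ h
    · simp [cap, h, Term.old, Term.subst] at hp
  | app f ts ih =>
    intro p hp
    by_cases h : OccursFrozen μ₀ l (.app f ts)
    · exact hl _ h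
    rw [cap, if_neg h] at hp
    split_ifs at hp with h3
    · simp [Term.old, Term.subst] at hp
    have hc : ∀ i, cap R μ₀ l (p ++ [i.val]) (ts i) = (ts i).old := by
      simp only [Term.old, Term.subst, Term.app.injEq, heq_eq_eq, true_and] at hp
      exact fun i => congrFun hp i
    rw [hp] at h3
    intro u hu
    rw [Term.subst] at hu
    rcases Strategy.step_iff.1 (show Strategy.full.step R _ _ from hu) with
      ⟨ρ, hρ, τ, e, -⟩ | ⟨g, us, i, v, e, hv, -⟩
    -- A root redex would unify the capped term with a left-hand side. The fresh variables do not
    -- occur in the embedded term, so their image is arbitrary.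
    · refine h3 ⟨ρ, hρ, Sum.elim σ fun _ => (Term.app f ts).subst σ, τ, ?_⟩
      rw [← e]
      have hold : ∀ t : Term S V,
          t.old.subst (Sum.elim σ fun _ => (Term.app f ts).subst σ) = t.subst σ := by
        intro t
        induction t with
        | var x => simp [Term.old, Term.subst]
        | app g us ih =>
          simp only [Term.old, Term.subst, Term.app.injEq, heq_eq_eq, true_and] at ih ⊢
          exact funext ih
      rw [hold, Term.subst]
    · cases e
      exact ih i _ (hc i) v hv

/-- An argument position outside `Υ(μ₀)` has an argument fixed by `cap`, and instances of such terms
are normal forms. Keeping `μ₀` and `μ` apart covers the fixed point (`μ₀ = μ`) as well as the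
innermost map (`μ₀ = ⊥`). -/
theorem FrozenNormal.rhs_subst (hμ : upsilon R μ₀ ≤ μ) {ρ : Rule S V} (hρ : ρ ∈ R)
    {σ : V → Term S V} (hl : ∀ t, OccursFrozen μ₀ ρ.lhs t → t.subst σ ∈ NF R)
    (hv : ∀ x ∈ ρ.rhs.vars, FrozenNormal μ R (σ x)) :
    ∀ t, ρ.rhs.HasSubterm t → FrozenNormal μ R (t.subst σ) := by
  intro t
  induction t with
  | var x =>
    intro h
    exact hv x (h.vars_subset (by rw [Term.vars]; rfl))
  | app f ts ih =>
    intro h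
    rw [Term.subst]
    refine .app _ _ (fun i _ => ih i (h.arg i)) fun i hi => ?_
    refine subst_mem_NF_of_cap_eq hl (ts i) [] ?_
    by_contra hc
    exact hi (hμ f ⟨ρ, hρ, ts, h, hc⟩)

/-- At the root, the frozen subterms of the left-hand side have normal instances: by the invariant
itself for full rewriting, by the innermost condition otherwise. Below the root, the rewritten
argument is replacing because it is reducible. -/
theorem FrozenNormal.step {st : Strategy} (hlhs : ∀ ρ ∈ R, ∀ x, ρ.lhs ≠ Term.var x)
    (hvars : ∀ ρ ∈ R, ρ.rhs.vars ⊆ ρ.lhs.vars) :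
    ∀ {s t : Term S V}, st.step R s t → FrozenNormal (st.usableMap R) R s →
      FrozenNormal (st.usableMap R) R t := by
  intro s
  induction s with
  | var x =>
    intro t h _
    rcases Strategy.step_iff.1 h with ⟨ρ, hρ, σ, e, -⟩ | ⟨g, us, i, v, e, -⟩
    · cases hc : ρ.lhs with
      | var y => exact absurd hc (hlhs ρ hρ y)
      | app f ts => rw [hc, Term.subst] at e; cases e
    · cases e
  | app f ts ih =>
    intro t h hs
    rcases Strategy.step_iff.1 h with ⟨ρ, hρ, σ, e, rfl, hin⟩ | ⟨g, us, i, v, e, hv, rfl⟩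
    · rw [e] at hs hin
      cases st with
      | full =>
        have hfix : upsilon R (Strategy.full.usableMap R) = Strategy.full.usableMap R :=
          OrderHom.map_lfp ⟨upsilon R, upsilon_mono R⟩
        refine FrozenNormal.rhs_subst hfix.le hρ
          (fun t ⟨p, h1, h2⟩ => hs.subst_mem_NF h1 h2) (fun x hx => ?_) _
          (Term.hasSubterm_refl _)
        obtain ⟨p, hp⟩ := Term.hasSubterm_var (hvars ρ hρ hx)
        exact hs.subtermAt (Term.subtermAt_subst σ hp)
      | innermost =>
        have hin' := hin rfl
        -- Only the root position is `⊥`-replacing, so the frozen subterms are the proper subterms,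
        -- whose instances are normal forms in an innermost redex.
        refine FrozenNormal.rhs_subst (μ₀ := ⊥) (le_refl (upsilon R ⊥)) hρ
          (fun t ⟨p, h1, h2⟩ => ?_) (fun x hx => ?_) _ (Term.hasSubterm_refl _)
        · refine hin' _ ⟨p, ?_, Term.subtermAt_subst σ h1⟩
          rintro rfl
          exact h2 (by simp [MuPos])
        · obtain ⟨p, hp⟩ := Term.hasSubterm_var (hvars ρ hρ hx)
          refine .of_mem_NF (hin' _ ⟨p, ?_, Term.subtermAt_subst σ hp⟩)
          rintro rfl
          rw [Term.SubtermAt] at hp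
          exact hlhs ρ hρ x hp
    · cases e
      exact hs.update (hs.mem_map (Strategy.step_toStep hv)) (ih i hv (hs.of_arg i))

/-- Ensures that replacing positions belong to symbols of the rules only, which stripping retains.
-/
theorem Strategy.exists_mem_funs_of_mem_usableMap {st : Strategy} {f : S.symbol}
    {i : Fin (S.arity f)} (h : i ∈ st.usableMap R f) : ∃ ρ ∈ R, f ∈ ρ.rhs.funs := by
  have key : ∀ ν : ReplacementMap S, i ∈ upsilon R ν f → ∃ ρ ∈ R, f ∈ ρ.rhs.funs := by
    rintro ν ⟨ρ, hρ, ts, hs, -⟩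
    exact ⟨ρ, hρ, hs.funs_subset (by rw [Term.funs]; exact Or.inl rfl)⟩
  cases st with
  | full =>
    have hfix : upsilon R (Strategy.full.usableMap R) = Strategy.full.usableMap R :=
      OrderHom.map_lfp ⟨upsilon R, upsilon_mono R⟩
    rw [← hfix] at h
    exact key _ h
  | innermost => exact key _ h

end Steps

/-! ### Embedding into the signature with marked and compound symbols -/

section Lift

variable {S : Signature.{u}} {V : Type v}

theorem Term.lift_subst (σ : V → Term S V) : ∀ t : Term S V,
    (t.subst σ).lift = t.lift.subst fun x => (σ x).lift
  | .var x => by simp [Term.subst, Term.lift]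
  | .app f ts => by
    simp only [Term.subst, Term.lift]
    exact congrArg _ (funext fun i => Term.lift_subst σ (ts i))

theorem Term.sharp_subst_app (σ : V → Term S V) (f : S.symbol)
    (ts : Fin (S.arity f) → Term S V) :
    (Term.app f fun i => (ts i).subst σ).sharp =
      (Term.app f ts).sharp.subst fun x => (σ x).lift := by
  simp only [Term.subst, Term.sharp]
  exact congrArg _ (funext fun i => Term.lift_subst σ (ts i))

theorem Term.vars_lift : ∀ t : Term S V, t.lift.vars = t.vars
  | .var x => by simp [Term.vars, Term.lift]
  | .app f ts => by
    simp only [Term.vars, Term.lift]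
    exact Set.iUnion_congr fun i => Term.vars_lift (ts i)

theorem Term.vars_sharp : ∀ t : Term S V, t.sharp.vars = t.vars
  | .var x => by simp [Term.vars, Term.sharp]
  | .app f ts => by
    simp only [Term.vars, Term.sharp]
    exact Set.iUnion_congr fun i => Term.vars_lift (ts i)

theorem Term.funs_lift : ∀ t : Term S V, t.lift.funs = DPSymbol.base '' t.funs
  | .var x => by simp [Term.funs, Term.lift]
  | .app f ts => by
    simp only [Term.funs, Term.lift, Set.image_union, Set.image_singleton, Set.image_iUnion]
    exact congrArg _ (Set.iUnion_congr fun i => Term.funs_lift (ts i))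

theorem Term.size_lift : ∀ t : Term S V, t.lift.size = t.size
  | .var x => by simp [Term.size, Term.lift]
  | .app f ts => by
    simp only [Term.size, Term.lift]
    exact congrArg _ (Finset.sum_congr rfl fun i _ => Term.size_lift (ts i))

theorem Term.size_sharp : ∀ t : Term S V, t.sharp.size = t.size
  | .var x => by simp [Term.size, Term.sharp]
  | .app f ts => by
    simp only [Term.size, Term.sharp]
    exact congrArg _ (Finset.sum_congr rfl fun i _ => Term.size_lift (ts i))

theorem Term.exists_subtermAt_of_lift {t : Term (dpSignature S V) V} :
    ∀ {s : Term S V} {p : List ℕ}, s.lift.SubtermAt p t →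
      ∃ s', s.SubtermAt p s' ∧ t = s'.lift
  | s, [], h => by
    rw [Term.SubtermAt] at h
    exact ⟨s, by rw [Term.SubtermAt], h.symm⟩
  | .var _, _ :: _, h => by simp [Term.lift, Term.SubtermAt] at h
  | .app f ts, i :: p, h => by
    rw [Term.lift, Term.SubtermAt] at h
    obtain ⟨hi, h⟩ := h
    obtain ⟨s', h1, h2⟩ := Term.exists_subtermAt_of_lift h
    exact ⟨s', by rw [Term.SubtermAt]; exact ⟨hi, h1⟩, h2⟩

/-- A left inverse of `Term.lift`. -/
noncomputable def Term.unlift [Nonempty V] : Term (dpSignature S V) V → Term S V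
  | .var x => .var x
  | .app (.base f) ts => .app f fun i => (ts i).unlift
  | .app (.sharp _) _ => .var (Classical.arbitrary V)
  | .app (.com _ _) _ => .var (Classical.arbitrary V)

theorem Term.unlift_lift [Nonempty V] : ∀ t : Term S V, t.lift.unlift = t
  | .var x => by simp [Term.lift, Term.unlift]
  | .app f ts => by
    simp only [Term.lift, Term.unlift]
    exact congrArg _ (funext fun i => Term.unlift_lift (ts i))

theorem Term.unlift_lift_subst [Nonempty V] (σ : V → Term (dpSignature S V) V) :
    ∀ t : Term S V, (t.lift.subst σ).unlift = t.subst fun x => (σ x).unlift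
  | .var x => by simp [Term.lift, Term.subst]
  | .app f ts => by
    simp only [Term.lift, Term.unlift, Term.subst]
    exact congrArg _ (funext fun i => Term.unlift_lift_subst σ (ts i))

theorem Term.lift_update (f : S.symbol) (ts : Fin (S.arity f) → Term S V)
    (i : Fin (S.arity f)) (u : Term S V) :
    (Term.app f (Function.update ts i u)).lift =
      .app (S := dpSignature S V) (.base f) (Function.update (fun j => (ts j).lift) i u.lift) := by
  rw [Term.lift]
  exact congrArg _ (funext fun j => Function.apply_update (fun _ t => Term.lift t) ts i u j)

theorem Term.sharp_update (f : S.symbol) (ts : Fin (S.arity f) → Term S V)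
    (i : Fin (S.arity f)) (u : Term S V) :
    (Term.app f (Function.update ts i u)).sharp =
      .app (S := dpSignature S V) (.sharp f)
        (Function.update (fun j => (ts j).lift) i u.lift) := by
  rw [Term.sharp]
  exact congrArg _ (funext fun j => Function.apply_update (fun _ t => Term.lift t) ts i u j)

end Lift

/-! ### Usable symbols -/

section Usable

variable {S : Signature.{u}} {V : Type v} {st : Strategy} {R : Set (Rule S V)}

/-- The dependency pairs of `R` together with their usable rules. -/
abbrev dpSystem (st : Strategy) (R : Set (Rule S V)) : Set (Rule (dpSignature S V) V) :=
  dependencyPairs st R ∪ usableRules R (dependencyPairs st R)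

/-- The symbols on which some right-hand side of a dependency pair depends. -/
def usableSymbols (st : Strategy) (R : Set (Rule S V)) : Set S.symbol :=
  {g | ∃ π ∈ dependencyPairs st R, ∃ f ∈ π.rhs.funs,
    Relation.ReflTransGen (Depends (liftRules R)) f (.base g)}

theorem mem_usableRules {ρ : Rule S V} (hρ : ρ ∈ R) {g : S.symbol}
    {ts : Fin (S.arity g) → Term S V} (h : ρ.lhs = .app g ts) (hg : g ∈ usableSymbols st R) :
    (⟨ρ.lhs.lift, ρ.rhs.lift⟩ : Rule (dpSignature S V) V) ∈
      usableRules R (dependencyPairs st R) := by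
  obtain ⟨π, hπ, f, hf, hfg⟩ := hg
  refine Set.mem_iUnion₂.2 ⟨π, hπ, ⟨ρ, hρ, rfl⟩, .base g, ⟨fun i => (ts i).lift, ?_⟩, f, hf, hfg⟩
  simp only [h]
  rw [Term.lift]

theorem mem_usableSymbols_of_mem_rhs {ρ : Rule S V} (hρ : ρ ∈ R) {g h : S.symbol}
    {ts : Fin (S.arity g) → Term S V} (hl : ρ.lhs = .app g ts) (hg : g ∈ usableSymbols st R)
    (hh : h ∈ ρ.rhs.funs) (hd : h ∈ defined R) : h ∈ usableSymbols st R := by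
  obtain ⟨π, hπ, f, hf, hfg⟩ := hg
  refine ⟨π, hπ, f, hf, hfg.tail ⟨_, ⟨ρ, hρ, rfl⟩, ⟨fun i => (ts i).lift, ?_⟩, ?_, ?_⟩⟩
  · simp only [hl]
    rw [Term.lift]
  · obtain ⟨ρ', hρ', us, e⟩ := hd
    refine ⟨_, ⟨ρ', hρ', rfl⟩, fun i => (us i).lift, ?_⟩
    simp only [e]
    rw [Term.lift]
  · simp only [Term.funs_lift]
    exact ⟨h, hh, rfl⟩

theorem usableRules_subset (P : Set (Rule (dpSignature S V) V)) :
    usableRules R P ⊆ liftRules R := by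
  intro π h
  obtain ⟨_, _, h, -⟩ := Set.mem_iUnion₂.1 h
  exact h

theorem hasSubterm_of_mem_outermost {D : Set S.symbol} {u : Term S V} : ∀ {t : Term S V},
    u ∈ outermost st D t → t.HasSubterm u
  | .var x, h => by
    cases st with
    | full =>
      simp only [outermost, List.mem_singleton] at h
      exact h ▸ Term.hasSubterm_refl _
    | innermost => simp [outermost] at h
  | .app f ts, h => by
    rw [outermost] at h
    split_ifs at h with hf
    · rw [List.mem_singleton] at h
      exact h ▸ Term.hasSubterm_refl _
    · obtain ⟨l, hl, hu⟩ := List.mem_flatten.1 h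
      obtain ⟨i, rfl⟩ := List.mem_ofFn.1 hl
      exact (hasSubterm_of_mem_outermost hu).of_arg

theorem compound_of_length_ne_one (ρ : Rule S V) :
    ∀ us : List (Term (dpSignature S V) V), us.length ≠ 1 →
      compound ρ us = .app (S := dpSignature S V) (.com ρ us.length) us.get
  | [], _ => rfl
  | [_], h => absurd rfl h
  | _ :: _ :: _, _ => rfl

theorem vars_compound (ρ : Rule S V) (us : List (Term (dpSignature S V) V)) :
    (compound ρ us).vars ⊆ ⋃ u ∈ us, u.vars := by
  by_cases h : us.length = 1
  · obtain ⟨u, rfl⟩ := List.length_eq_one_iff.1 h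
    simp [compound]
  · rw [compound_of_length_ne_one ρ us h, Term.vars]
    exact Set.iUnion_subset fun i => Set.subset_biUnion_of_mem (u := fun u => Term.vars u)
      (List.get_mem us i)

theorem funs_subset_compound (ρ : Rule S V) {us : List (Term (dpSignature S V) V)}
    {u : Term (dpSignature S V) V} (hu : u ∈ us) : u.funs ⊆ (compound ρ us).funs := by
  by_cases h : us.length = 1
  · obtain ⟨v, rfl⟩ := List.length_eq_one_iff.1 h
    rw [List.mem_singleton] at hu
    simp [compound, hu]
  · rw [compound_of_length_ne_one ρ us h, Term.funs]
    obtain ⟨i, rfl⟩ := List.get_of_mem hu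
    exact (Set.subset_iUnion (fun i : Fin us.length => (us.get i).funs) i).trans
      Set.subset_union_right

theorem IsTRS.dpSystem_lhs_ne_var (hR : IsTRS R) :
    ∀ π ∈ dpSystem st R, ∀ x, π.lhs ≠ Term.var x := by
  rintro π (⟨ρ, hρ, rfl⟩ | h) x e
  · cases hl : ρ.lhs with
    | var y => exact hR.lhs_ne_var ρ hρ y hl
    | app f ts => simp [dependencyPair, hl, Term.sharp] at e
  · obtain ⟨ρ, hρ, rfl⟩ := usableRules_subset _ h
    cases hl : ρ.lhs with
    | var y => exact hR.lhs_ne_var ρ hρ y hl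
    | app f ts => simp [hl, Term.lift] at e

theorem IsTRS.dpSystem_vars_subset (hR : IsTRS R) :
    ∀ π ∈ dpSystem st R, π.rhs.vars ⊆ π.lhs.vars := by
  rintro π (⟨ρ, hρ, rfl⟩ | h)
  · refine (vars_compound _ _).trans (Set.iUnion₂_subset fun u hu => ?_)
    obtain ⟨t, ht, rfl⟩ := List.mem_map.1 hu
    simp only [dependencyPair, Term.vars_sharp]
    exact (hasSubterm_of_mem_outermost ht).vars_subset.trans (hR.vars_subset ρ hρ)
  · obtain ⟨ρ, hρ, rfl⟩ := usableRules_subset _ h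
    simp only [Term.vars_lift]
    exact hR.vars_subset ρ hρ

/-- Lifted terms contain no marked symbol, so no dependency pair matches. A match of a usable rule
may use a substitution into extended terms; `Term.unlift` turns it into an `R`-redex of `s`. -/
theorem Term.lift_mem_NF [Nonempty V] (hR : IsTRS R) : ∀ {s : Term S V}, s ∈ NF R →
    s.lift ∈ NF (dpSystem st R) := by
  intro s
  induction s with
  | var x =>
    intro _ u hu
    rcases Strategy.step_iff.1 (show Strategy.full.step _ _ _ from hu) with
      ⟨π, hπ, σ, e, -⟩ | ⟨g, us, i, v, e, -⟩
    · cases hc : π.lhs with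
      | var y => exact hR.dpSystem_lhs_ne_var π hπ y hc
      | app f ts => rw [hc, Term.lift, Term.subst] at e; cases e
    · rw [Term.lift] at e; cases e
  | app f ts ih =>
    intro hs u hu
    rcases Strategy.step_iff.1 (show Strategy.full.step _ _ _ from hu) with
      ⟨π, hπ, σ, e, -⟩ | ⟨g, us, i, v, e, hv, -⟩
    · rcases hπ with ⟨ρ, hρ, rfl⟩ | h
      · cases hl : ρ.lhs with
        | var y => exact hR.lhs_ne_var ρ hρ y hl
        | app g us =>
          simp only [dependencyPair, hl, Term.sharp, Term.lift, Term.subst] at e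
          cases e
      · obtain ⟨ρ, hρ, rfl⟩ := usableRules_subset _ h
        have e' := congrArg Term.unlift e
        rw [Term.unlift_lift, Term.unlift_lift_subst] at e'
        rw [e'] at hs
        exact hs _ (Step.root ρ hρ _)
    · rw [Term.lift] at e
      cases e
      exact ih i (NF.arg hs i) v hv

/-- All defined symbols of `s` are usable. -/
def UsableFuns (st : Strategy) (R : Set (Rule S V)) (s : Term S V) : Prop :=
  ∀ g ∈ s.funs, g ∈ defined R → g ∈ usableSymbols st R

theorem UsableFuns.of_hasSubterm {s t : Term S V} (h : UsableFuns st R s)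
    (hs : s.HasSubterm t) : UsableFuns st R t :=
  fun g hg => h g (hs.funs_subset hg)

theorem UsableFuns.app_iff {f : S.symbol} {ts : Fin (S.arity f) → Term S V} :
    UsableFuns st R (.app f ts) ↔
      (f ∈ defined R → f ∈ usableSymbols st R) ∧ ∀ i, UsableFuns st R (ts i) := by
  simp only [UsableFuns, Term.funs, Set.mem_union, Set.mem_singleton_iff, Set.mem_iUnion]
  grind

theorem UsableFuns.update {f : S.symbol} {ts : Fin (S.arity f) → Term S V}
    (h : ∀ i, UsableFuns st R (ts i)) (i : Fin (S.arity f)) {u : Term S V}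
    (hu : UsableFuns st R u) (j : Fin (S.arity f)) :
    UsableFuns st R (Function.update ts i u j) := by
  rcases eq_or_ne j i with rfl | hne
  · simpa using hu
  · rw [Function.update_of_ne hne]; exact h j

/-- The root of a redex is a usable symbol, so the applied rule is a usable rule, and usability is
inherited by the defined symbols of its right-hand side. -/
theorem UsableFuns.step [Nonempty V] (hR : IsTRS R) : ∀ {s t : Term S V}, UsableFuns st R s →
    st.step R s t → UsableFuns st R t ∧ st.step (dpSystem st R) s.lift t.lift ∧
      Step (usableRules R (dependencyPairs st R)) s.lift t.lift := by
  intro s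
  induction s with
  | var x =>
    intro t _ h
    rcases Strategy.step_iff.1 h with ⟨ρ, hρ, σ, e, -⟩ | ⟨g, us, i, v, e, -⟩
    · cases hc : ρ.lhs with
      | var y => exact absurd hc (hR.lhs_ne_var ρ hρ y)
      | app f ts => rw [hc, Term.subst] at e; cases e
    · cases e
  | app f ts ih =>
    intro t hs h
    rcases Strategy.step_iff.1 h with ⟨ρ, hρ, σ, e, rfl, hin⟩ | ⟨g, us, i, v, e, hv, rfl⟩
    · cases hl : ρ.lhs with
      | var y => exact absurd hl (hR.lhs_ne_var ρ hρ y)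
      | app g us =>
        have e0 := e
        rw [hl, Term.subst] at e0
        cases e0
        have hf : f ∈ usableSymbols st R := (UsableFuns.app_iff.1 hs).1 ⟨ρ, hρ, us, hl⟩
        have hmem := mem_usableRules hρ hl hf
        refine ⟨fun h hh hd => ?_, ?_, ?_⟩
        · rcases Term.funs_subst hh with h1 | ⟨x, hx, h1⟩
          · exact mem_usableSymbols_of_mem_rhs hρ hl hf h1 hd
          · obtain ⟨p, hp⟩ := Term.hasSubterm_var (hR.vars_subset ρ hρ hx)
            refine hs h (Term.HasSubterm.funs_subset ⟨p, ?_⟩ h1) hd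
            rw [e]
            exact Term.subtermAt_subst σ hp
        · refine Strategy.step_iff.2 (Or.inl ⟨_, Or.inr hmem, fun x => (σ x).lift, ?_,
            Term.lift_subst σ _, ?_⟩)
          · rw [e]; exact Term.lift_subst σ _
          · rintro hst u ⟨p, hp, hu⟩
            obtain ⟨s', h1, rfl⟩ := Term.exists_subtermAt_of_lift hu
            exact Term.lift_mem_NF hR (hin hst s' ⟨p, hp, h1⟩)
        · rw [e, Term.lift_subst, Term.lift_subst]
          exact Step.root _ hmem _
    · cases e
      obtain ⟨h1, h2, h3⟩ := ih i ((UsableFuns.app_iff.1 hs).2 i) hv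
      rw [Term.lift_update]
      exact ⟨UsableFuns.app_iff.2 ⟨(UsableFuns.app_iff.1 hs).1,
        UsableFuns.update (UsableFuns.app_iff.1 hs).2 i h1⟩,
        Strategy.step_arg (S := dpSignature S V) (.base f) _ i h2,
        Step.arg (S := dpSignature S V) (.base f) _ i _ h3⟩

end Usable

/-! ### Simulation of derivations by dependency pairs and usable rules -/

section Simulation

variable {S : Signature.{u}} {V : Type v} {st : Strategy} {R : Set (Rule S V)}

/-- Rewriting at the root. -/
def RootStep (P : Set (Rule S V)) (s t : Term S V) : Prop :=
  ∃ π ∈ P, ∃ σ : V → Term S V, s = π.lhs.subst σ ∧ t = π.rhs.subst σ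

/-- The closure of a relation under contexts built from compound symbols. -/
inductive CompoundClosure (r : Term (dpSignature S V) V → Term (dpSignature S V) V → Prop) :
    Term (dpSignature S V) V → Term (dpSignature S V) V → Prop
  | root (s t) : r s t → CompoundClosure r s t
  | arg (ρ : Rule S V) (n : ℕ) (ts : Fin n → Term (dpSignature S V) V) (i : Fin n) (u) :
      CompoundClosure r (ts i) u →
      CompoundClosure r (.app (S := dpSignature S V) (.com ρ n) ts)
        (.app (S := dpSignature S V) (.com ρ n) (Function.update ts i u))

/-- `s` is a tree of compound symbols with the leaves `M`. -/
inductive CompoundTree : Term (dpSignature S V) V → Multiset (Term (dpSignature S V) V) → Prop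
  | leaf (u) : CompoundTree u {u}
  | node (ρ : Rule S V) (n : ℕ) (ts : Fin n → Term (dpSignature S V) V)
      (M : Fin n → Multiset (Term (dpSignature S V) V)) :
      (∀ i, CompoundTree (ts i) (M i)) →
      CompoundTree (.app (S := dpSignature S V) (.com ρ n) ts) (∑ i, M i)

/-- Outside normal forms, the redexes of `s` lie in disjoint subterms that correspond to the
marked or unmarked terms of `M`. -/
inductive Covers (st : Strategy) (R : Set (Rule S V)) :
    Term S V → Multiset (Term (dpSignature S V) V) → Prop
  | lift (s) : UsableFuns st R s → Covers st R s {s.lift}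
  | sharp (f) (ts : Fin (S.arity f) → Term S V) : (∀ i, UsableFuns st R (ts i)) →
      Covers st R (.app f ts) {(Term.app f ts).sharp}
  | nf (s) : s ∈ NF R → Covers st R s 0
  | node (f) (ts : Fin (S.arity f) → Term S V)
      (M : Fin (S.arity f) → Multiset (Term (dpSignature S V) V)) : f ∉ defined R →
      (∀ i, Covers st R (ts i) (M i)) → Covers st R (.app f ts) (∑ i, M i)

/-- A step with a usable rule, or a root step with a dependency pair. -/
def LeafStep (st : Strategy) (R : Set (Rule S V)) (s t : Term (dpSignature S V) V) : Prop :=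
  st.step (dpSystem st R) s t ∧
    (Step (usableRules R (dependencyPairs st R)) s t ∨ RootStep (dependencyPairs st R) s t)

/-- Exchange of one leaf `u` for the leaves `N`: the same remainder `K` serves before and after the
exchange. -/
theorem sum_update_eq_add {ι α : Type*} [Fintype ι] [DecidableEq ι] {M : ι → Multiset α} {i : ι} {u : α}
    {M' : Multiset α} (h : M i = u ::ₘ M') :
    ∃ K, ∑ j, M j = u ::ₘ K ∧ ∀ N, ∑ j, Function.update M i (N + M') j = N + K := by
  refine ⟨M' + ∑ j ∈ Finset.univ \ {i}, M j, ?_, fun N => ?_⟩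
  · rw [← Multiset.cons_add, ← h]
    exact Finset.sum_eq_add_sum_sdiff_singleton_of_mem (Finset.mem_univ i) M
  · rw [Finset.sum_update_of_mem (Finset.mem_univ i), add_assoc]

theorem coe_ofFn_eq_sum {α : Type*} : ∀ {n : ℕ} (g : Fin n → α),
    (List.ofFn g : Multiset α) = ∑ i, {g i}
  | 0, _ => by simp
  | n + 1, g => by
    rw [List.ofFn_succ, Fin.sum_univ_succ, ← coe_ofFn_eq_sum, ← Multiset.cons_coe,
      Multiset.singleton_add]

theorem coe_flatten_ofFn_eq_sum {α : Type*} : ∀ {n : ℕ} (g : Fin n → List α),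
    ((List.ofFn g).flatten : Multiset α) = ∑ i, (g i : Multiset α)
  | 0, _ => by simp
  | n + 1, g => by
    rw [List.ofFn_succ, Fin.sum_univ_succ, ← coe_flatten_ofFn_eq_sum, List.flatten_cons,
      Multiset.coe_add]

theorem CompoundTree.replace {r : Term (dpSignature S V) V → Term (dpSignature S V) V → Prop}
    {s : Term (dpSignature S V) V} {M : Multiset (Term (dpSignature S V) V)}
    (h : CompoundTree s M) : ∀ {u K t N}, M = u ::ₘ K → r u t → CompoundTree t N →
      ∃ s', CompoundClosure r s s' ∧ CompoundTree s' (N + K) := by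
  induction h with
  | leaf v =>
    intro u K t N hM hr ht
    obtain ⟨rfl, rfl⟩ := Multiset.singleton_eq_cons_iff _ |>.1 hM
    exact ⟨t, .root _ _ hr, by simpa using ht⟩
  | node ρ n ts M hM ih =>
    intro u K t N hu hr ht
    have hmem : u ∈ ∑ i, M i := hu ▸ Multiset.mem_cons_self u K
    obtain ⟨i, -, hi⟩ := Multiset.mem_sum.1 hmem
    obtain ⟨M', hM'⟩ := Multiset.exists_cons_of_mem hi
    obtain ⟨K', hK', hN⟩ := sum_update_eq_add hM'
    obtain ⟨s', h1, h2⟩ := ih i hM' hr ht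
    obtain rfl : K = K' := by
      rw [hK'] at hu
      exact ((Multiset.cons_inj_right u).1 hu).symm
    refine ⟨_, .arg ρ n ts i s' h1, ?_⟩
    rw [← hN N]
    refine .node ρ n _ _ fun j => ?_
    rcases eq_or_ne j i with rfl | hne
    · simpa using h2
    · rw [Function.update_of_ne hne, Function.update_of_ne hne]
      exact hM j

theorem CompoundTree.compound_subst (ρ : Rule S V) (us : List (Term (dpSignature S V) V))
    (σ : V → Term (dpSignature S V) V) :
    CompoundTree ((compound ρ us).subst σ) ↑(us.map fun u => u.subst σ) := by
  by_cases h : us.length = 1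
  · obtain ⟨u, rfl⟩ := List.length_eq_one_iff.1 h
    exact .leaf _
  · rw [compound_of_length_ne_one ρ us h, Term.subst]
    have e : (↑(us.map fun u => u.subst σ) : Multiset (Term (dpSignature S V) V)) =
        ∑ i : Fin us.length, {(us.get i).subst σ} := by
      conv_lhs => rw [← List.ofFn_get us, List.map_ofFn]
      exact coe_ofFn_eq_sum _
    rw [e]
    exact .node ρ us.length _ _ fun i => .leaf _

/-- The outermost subterms of the right-hand side are the new leaves. Under the innermost strategy
variables yield none, since they are instantiated by normal forms. The roots of marked leaves need
not be usable, which is why the symbols of `u.sharp` rather than of `u` are considered. -/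
theorem Covers.rhs_subst {σ : V → Term S V} : ∀ {r : Term S V},
    (∀ x ∈ r.vars, UsableFuns st R (σ x)) →
    (st = .innermost → ∀ x ∈ r.vars, σ x ∈ NF R) →
    (∀ u ∈ outermost st (defined R) r, ∀ g ∈ u.sharp.funs, ∀ h, g = .base h →
      h ∈ usableSymbols st R) →
    Covers st R (r.subst σ) ((outermost st (defined R) r).map fun u =>
      u.sharp.subst fun x => (σ x).lift : List (Term (dpSignature S V) V)) := by
  intro r
  induction r with
  | var x =>
    intro hv hn _
    have hx : x ∈ (Term.var x : Term S V).vars := by rw [Term.vars]; rfl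
    cases st with
    | full => exact .lift _ (hv x hx)
    | innermost => exact .nf _ (hn rfl x hx)
  | app f ts ih =>
    intro hv hn hu
    have hsub : ∀ i, (ts i).vars ⊆ (Term.app f ts).vars := fun i => by
      rw [Term.vars]; exact Set.subset_iUnion (fun i => (ts i).vars) i
    rw [outermost] at hu ⊢
    rw [Term.subst]
    split_ifs at hu ⊢ with hf
    · rw [List.map_singleton, ← Term.sharp_subst_app]
      refine .sharp f _ fun i g hg hd => ?_
      rcases Term.funs_subst hg with h1 | ⟨x, hx, h1⟩
      · refine hu _ (List.mem_singleton_self _) (.base g) ?_ g rfl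
        rw [Term.sharp, Term.funs]
        refine Or.inr (Set.mem_iUnion.2 ⟨i, ?_⟩)
        rw [Term.funs_lift]
        exact ⟨g, h1, rfl⟩
      · exact hv x (hsub i hx) g h1 hd
    · have hmem : ∀ i, ∀ u ∈ outermost st (defined R) (ts i),
          u ∈ (List.ofFn fun i => outermost st (defined R) (ts i)).flatten := fun i u h =>
        List.mem_flatten.2 ⟨_, List.mem_ofFn.2 ⟨i, rfl⟩, h⟩
      have key := Covers.node f _ _ hf fun i => ih i (fun x hx => hv x (hsub i hx))
        (fun h x hx => hn h x (hsub i hx)) (fun u h => hu u (hmem i u h))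
      convert key using 1
      rw [List.map_flatten, List.map_ofFn]
      exact coe_flatten_ofFn_eq_sum _

/-- A root step becomes a step with the dependency pair of the rule and may split the leaf; a step
in an argument is one with a usable rule and keeps the leaf marked. -/
theorem LeafStep.of_sharp [Nonempty V] (hR : IsTRS R) {f : S.symbol}
    {ts : Fin (S.arity f) → Term S V} (hs : ∀ i, UsableFuns st R (ts i)) {t : Term S V}
    (h : st.step R (.app f ts) t) :
    ∃ t' N, LeafStep st R (Term.app f ts).sharp t' ∧ CompoundTree t' N ∧ Covers st R t N := by
  rcases Strategy.step_iff.1 h with ⟨ρ, hρ, σ, e, rfl, hin⟩ | ⟨g, us, i, v, e, hv, rfl⟩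
  · cases hl : ρ.lhs with
    | var y => exact absurd hl (hR.lhs_ne_var ρ hρ y)
    | app g us =>
      have e0 := e
      rw [hl, Term.subst] at e0
      cases e0
      have hmem : dependencyPair st R ρ ∈ dependencyPairs st R := ⟨ρ, hρ, rfl⟩
      have elhs : (Term.app f fun i => (us i).subst σ).sharp =
          (dependencyPair st R ρ).lhs.subst fun x => (σ x).lift := by
        rw [Term.sharp_subst_app]
        simp only [dependencyPair, hl]
      have hvar : ∀ x ∈ ρ.rhs.vars, ∃ i, (us i).HasSubterm (.var x) := fun x hx => by
        have h1 := hR.vars_subset ρ hρ hx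
        rw [hl, Term.vars] at h1
        obtain ⟨i, hi⟩ := Set.mem_iUnion.1 h1
        exact ⟨i, Term.hasSubterm_var hi⟩
      refine ⟨_, _, ⟨Strategy.step_iff.2 (Or.inl ⟨_, Or.inl hmem, _, elhs, rfl, ?_⟩),
        Or.inr ⟨_, hmem, _, elhs, rfl⟩⟩, CompoundTree.compound_subst ρ _ _, ?_⟩
      · rintro hst u hu
        rw [Term.sharp] at hu
        obtain ⟨i, p, hp⟩ := Term.exists_hasSubterm_arg_of_hasProperSubterm hu
        obtain ⟨s', h1, rfl⟩ := Term.exists_subtermAt_of_lift hp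
        exact Term.lift_mem_NF hR (hin hst s' (Term.hasProperSubterm_arg f _ i ⟨p, h1⟩))
      · rw [List.map_map]
        refine Covers.rhs_subst (fun x hx => ?_) (fun hst x hx => ?_) fun u hu g hg k hk => ?_
        · obtain ⟨i, p, hp⟩ := hvar x hx
          exact (hs i).of_hasSubterm ⟨p, Term.subtermAt_subst σ hp⟩
        · obtain ⟨i, p, hp⟩ := hvar x hx
          exact hin hst _ (Term.hasProperSubterm_arg _ _ i ⟨p, Term.subtermAt_subst σ hp⟩)
        · subst hk
          exact ⟨_, hmem, _, funs_subset_compound ρ (List.mem_map_of_mem hu) hg, .refl⟩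
  · cases e
    obtain ⟨h1, h2, h3⟩ := UsableFuns.step hR (hs i) hv
    refine ⟨(Term.app f (Function.update ts i v)).sharp, _, ?_, .leaf _,
      .sharp _ _ (UsableFuns.update hs i h1)⟩
    rw [Term.sharp_update]
    exact ⟨Strategy.step_arg (S := dpSignature S V) (.sharp f) _ i h2,
      Or.inl (Step.arg (S := dpSignature S V) (.sharp f) _ i _ h3)⟩

/-- The symbols above the leaves are not defined and the uncovered parts are normal, so every step
happens within a single leaf. -/
theorem Covers.step [Nonempty V] (hR : IsTRS R) {s : Term S V}
    {M : Multiset (Term (dpSignature S V) V)} (hs : Covers st R s M) :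
    ∀ {t : Term S V}, st.step R s t → ∃ u K t' N, M = u ::ₘ K ∧ LeafStep st R u t' ∧
      CompoundTree t' N ∧ Covers st R t (N + K) := by
  induction hs with
  | lift s hs =>
    intro t h
    obtain ⟨h1, h2, h3⟩ := UsableFuns.step hR hs h
    exact ⟨s.lift, 0, t.lift, {t.lift}, rfl, ⟨h2, Or.inl h3⟩, .leaf _, .lift _ h1⟩
  | sharp f ts hs =>
    intro t h
    obtain ⟨t', N, h1, h2, h3⟩ := LeafStep.of_sharp hR hs h
    exact ⟨_, 0, t', N, rfl, h1, h2, by simpa using h3⟩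
  | nf s hs => exact fun h => absurd (Strategy.step_toStep h) (hs _)
  | node f ts M hf hM ih =>
    intro t h
    rcases Strategy.step_iff.1 h with ⟨ρ, hρ, σ, e, -⟩ | ⟨g, us, i, v, e, hv, rfl⟩
    · cases hl : ρ.lhs with
      | var y => exact absurd hl (hR.lhs_ne_var ρ hρ y)
      | app g us =>
        rw [hl, Term.subst] at e
        cases e
        exact absurd ⟨ρ, hρ, us, hl⟩ hf
    · cases e
      obtain ⟨u, M', t', N, h1, h2, h3, h4⟩ := ih i hv
      obtain ⟨K, hK, hN⟩ := sum_update_eq_add h1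
      refine ⟨u, K, t', N, hK, h2, h3, ?_⟩
      rw [← hN N]
      refine .node f _ _ hf fun j => ?_
      rcases eq_or_ne j i with rfl | hne
      · simpa using h4
      · rw [Function.update_of_ne hne, Function.update_of_ne hne]
        exact hM j

theorem CompoundClosure.of_leafStep {s t : Term (dpSignature S V) V}
    (h : CompoundClosure (LeafStep st R) s t) :
    st.step (dpSystem st R) s t ∧ (Step (usableRules R (dependencyPairs st R)) s t ∨
      CompoundClosure (RootStep (dependencyPairs st R)) s t) := by
  induction h with
  | root s t h => exact ⟨h.1, h.2.imp_right (.root _ _)⟩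
  | arg ρ n ts i u _ ih =>
    exact ⟨Strategy.step_arg (S := dpSignature S V) (.com ρ n) _ i ih.1,
      ih.2.imp (Step.arg (S := dpSignature S V) (.com ρ n) _ i _) (.arg ρ n _ i _)⟩

/-- Derivations of `R` are bounded by weights for which steps with usable rules and with
dependency pairs behave as in the weight gap principle. -/
theorem length_le_of_weights [Nonempty V] (hR : IsTRS R) {wA wB : Term (dpSignature S V) V → ℕ}
    {Δ : ℕ}
    (hU : ∀ s t, FrozenNormal (dpUsableMap st R) (dpSystem st R) s →
      Step (usableRules R (dependencyPairs st R)) s t → wA t < wA s ∧ wB t ≤ wB s)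
    (hP : ∀ s t, FrozenNormal (dpUsableMap st R) (dpSystem st R) s →
      st.step (dpSystem st R) s t →
      CompoundClosure (RootStep (dependencyPairs st R)) s t → wA t ≤ wA s + Δ ∧ wB t < wB s)
    {n : ℕ} {s t : Term S V} (h : Steps (st.step R) n s t) :
    ∀ {s' M}, FrozenNormal (dpUsableMap st R) (dpSystem st R) s' → CompoundTree s' M →
      Covers st R s M → n ≤ wA s' + (Δ + 1) * wB s' := by
  induction h with
  | zero s => exact fun _ _ _ => Nat.zero_le _
  | succ n s t u hst _ ih =>
    intro s' M h1 h2 h3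
    obtain ⟨v, K, v', N, hM, h4, h5, h6⟩ := h3.step hR hst
    obtain ⟨t', h7, h8⟩ := h2.replace hM h4 h5
    obtain ⟨h9, h10⟩ := h7.of_leafStep
    have h11 := ih (FrozenNormal.step hR.dpSystem_lhs_ne_var hR.dpSystem_vars_subset h9 h1) h8 h6
    rcases h10 with h10 | h10
    · obtain ⟨ha, hb⟩ := hU _ _ h1 h10
      have := Nat.mul_le_mul_left (Δ + 1) hb
      omega
    -- The first summand gains at most `Δ` and the second loses at least `Δ + 1`, so the weight pays
    -- for this step too.
    · obtain ⟨ha, hb⟩ := hP _ _ h1 h9 h10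
      have := Nat.mul_le_mul_left (Δ + 1) hb
      rw [Nat.mul_succ] at this
      omega

theorem Term.mem_NF_of_disjoint (hR : IsTRS R) : ∀ {t : Term S V},
    Disjoint t.funs (defined R) → t ∈ NF R := by
  intro t
  induction t with
  | var x =>
    intro _ u hu
    rcases Strategy.step_iff.1 (show Strategy.full.step _ _ _ from hu) with
      ⟨ρ, hρ, σ, e, -⟩ | ⟨g, us, i, v, e, -⟩
    · cases hc : ρ.lhs with
      | var y => exact hR.lhs_ne_var ρ hρ y hc
      | app f ts => rw [hc, Term.subst] at e; cases e
    · cases e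
  | app f ts ih =>
    intro hd u hu
    rw [Term.funs] at hd
    rcases Strategy.step_iff.1 (show Strategy.full.step _ _ _ from hu) with
      ⟨ρ, hρ, σ, e, -⟩ | ⟨g, us, i, v, e, hv, -⟩
    · cases hl : ρ.lhs with
      | var y => exact hR.lhs_ne_var ρ hρ y hl
      | app g us =>
        rw [hl, Term.subst] at e
        cases e
        exact Set.disjoint_left.1 hd (Or.inl rfl) ⟨ρ, hρ, us, hl⟩
    · cases e
      refine ih i (hd.mono_left ?_) v hv
      exact (Set.subset_iUnion (fun i => (ts i).funs) i).trans Set.subset_union_right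

/-- The arguments of a basic term are free of defined symbols, hence normal and vacuously usable;
the simulation starts from the single leaf `s.sharp`. -/
theorem length_le_of_basic [Nonempty V] (hR : IsTRS R)
    {wA wB : Term (dpSignature S V) V → ℕ} {Δ : ℕ}
    (hU : ∀ s t, FrozenNormal (dpUsableMap st R) (dpSystem st R) s →
      Step (usableRules R (dependencyPairs st R)) s t → wA t < wA s ∧ wB t ≤ wB s)
    (hP : ∀ s t, FrozenNormal (dpUsableMap st R) (dpSystem st R) s →
      st.step (dpSystem st R) s t →
      CompoundClosure (RootStep (dependencyPairs st R)) s t → wA t ≤ wA s + Δ ∧ wB t < wB s)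
    {n : ℕ} {s t : Term S V} (hs : s ∈ basicTerms R) (h : Steps (st.step R) n s t) :
    n ≤ wA s.sharp + (Δ + 1) * wB s.sharp := by
  obtain ⟨f, ts, rfl, -, hd⟩ := hs
  have hnf : ∀ i, (ts i).lift ∈ NF (dpSystem st R) := fun i =>
    Term.lift_mem_NF hR (Term.mem_NF_of_disjoint hR (hd i))
  refine length_le_of_weights hR hU hP h ?_ (.leaf _)
    (.sharp f ts fun i g hg hgd => absurd hgd (Set.disjoint_left.1 (hd i) hg))
  rw [Term.sharp]
  exact .app (S := dpSignature S V) _ _ (fun i _ => .of_mem_NF (hnf i)) fun i _ => hnf i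

end Simulation

/-! ### Stripping of foreign symbols, and weights along usable-rule steps -/

section Weights

variable {S : Signature.{u}} {V : Type v} {d : ℕ}

theorem Step.mono {R Q : Set (Rule S V)} (h : R ⊆ Q) {s t : Term S V} (hs : Step R s t) :
    Step Q s t := by
  induction hs with
  | root ρ hρ σ => exact .root ρ (h hρ) σ
  | arg f ts i u _ ih => exact .arg f ts i u ih

/-- Replacement of all outermost subterms with a root outside `X` by the variable `x`. -/
noncomputable def Term.strip (X : Set S.symbol) (x : V) : Term S V → Term S V
  | .var y => .var y
  | .app f ts => if f ∈ X then .app f fun i => (ts i).strip X x else .var x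

variable {X : Set S.symbol} {x : V}

theorem Term.strip_subst (σ : V → Term S V) : ∀ {t : Term S V}, t.funs ⊆ X →
    (t.subst σ).strip X x = t.subst fun y => (σ y).strip X x
  | .var y, _ => by simp [Term.subst]
  | .app f ts, h => by
    rw [Term.funs] at h
    rw [Term.subst, Term.strip, if_pos (h (Or.inl rfl)), Term.subst]
    exact congrArg _ (funext fun i => Term.strip_subst σ fun g hg =>
      h (Or.inr (Set.mem_iUnion.2 ⟨i, hg⟩)))

theorem Term.strip_update {f : S.symbol} (hf : f ∈ X) (ts : Fin (S.arity f) → Term S V)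
    (i : Fin (S.arity f)) (u : Term S V) :
    (Term.app f (Function.update ts i u)).strip X x =
      .app f (Function.update (fun j => (ts j).strip X x) i (u.strip X x)) := by
  rw [Term.strip, if_pos hf]
  exact congrArg _ (funext fun j => Function.apply_update (fun _ t => Term.strip X x t) ts i u j)

namespace MatrixInterp

theorem eval_subst (A : MatrixInterp S d) (α : V → Fin d → ℕ) (σ : V → Term S V) :
    ∀ t : Term S V, A.eval α (t.subst σ) = A.eval (fun y => A.eval α (σ y)) t
  | .var y => by simp [Term.subst, eval]
  | .app f ts => by
    simp only [Term.subst, eval]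
    exact congrArg _ (funext fun i => eval_subst A α σ (ts i))

theorem interp_apply (A : MatrixInterp S d) (f : S.symbol) (y : Fin (S.arity f) → Fin d → ℕ)
    (j : Fin d) : A.interp f y j = ∑ i, ∑ k, A.mat f i j k * y i k + A.vec f j := by
  simp [interp, Matrix.mulVec, dotProduct, Finset.sum_apply]

theorem interp_mono (A : MatrixInterp S d) (f : S.symbol) {y z : Fin (S.arity f) → Fin d → ℕ}
    (h : ∀ i, y i ≤ z i) : A.interp f y ≤ A.interp f z := by
  intro j
  rw [interp_apply, interp_apply]
  gcongr with i _ k _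
  exact h i k

/-- The erased subterms become a variable, whose value under the zero assignment is `0`. Thus bounds
on the unstripped values carry over. -/
theorem eval_strip_le (A : MatrixInterp S d) : ∀ t : Term S V,
    A.eval 0 (t.strip X x) ≤ A.eval 0 t
  | .var y => by rw [Term.strip]
  | .app f ts => by
    rw [Term.strip]
    split_ifs with hf
    · simp only [eval]
      exact A.interp_mono f fun i => eval_strip_le A (ts i)
    · rw [eval]
      exact fun j => Nat.zero_le _

theorem eval_update (A : MatrixInterp S d) (α : V → Fin d → ℕ) (f : S.symbol)
    (ts : Fin (S.arity f) → Term S V) (i : Fin (S.arity f)) (u : Term S V) :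
    A.eval α (.app f (Function.update ts i u)) =
      A.interp f (Function.update (fun j => A.eval α (ts j)) i (A.eval α u)) := by
  rw [eval]
  exact congrArg _ (funext fun j => Function.apply_update (fun _ t => A.eval α t) ts i u j)

/-- A step inside an erased subterm would leave the weight unchanged. It cannot occur: by
`FrozenNormal` the step is at a replacing position, and the symbols above it lie in `X`. -/
theorem vecGT_eval_strip_of_step [NeZero d] {A : MatrixInterp S d} {μ : ReplacementMap S}
    {U Q : Set (Rule S V)} (hA : A.IsMuMonotone μ) (hμ : ∀ f, ∀ i ∈ μ f, f ∈ X)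
    (hX : ∀ π ∈ U, π.lhs.funs ⊆ X ∧ π.rhs.funs ⊆ X) (hU : Orients A.TermGT U) (hUQ : U ⊆ Q)
    (α : V → Fin d → ℕ) {s t : Term S V} (h : Step U s t) : FrozenNormal μ Q s →
      VecGT (A.eval α (s.strip X x)) (A.eval α (t.strip X x)) := by
  induction h with
  | root π hπ σ =>
    intro _
    rw [Term.strip_subst σ (hX π hπ).1, Term.strip_subst σ (hX π hπ).2, eval_subst, eval_subst]
    exact hU π hπ _
  | arg f ts i u h ih =>
    intro hs
    have hi := hs.mem_map (h.mono hUQ)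
    have e := Term.strip_update (x := x) (hμ f i hi) ts i (ts i)
    rw [Function.update_eq_self] at e
    rw [Term.strip_update (hμ f i hi), e, eval_update, eval_update]
    exact hA f i hi _ _ _ (ih (hs.of_arg i))

/-- Matrices over `ℕ` are weakly monotone in every argument, so no replacement map is involved; a
step inside an erased subterm changes nothing. -/
theorem eval_strip_le_of_step {A : MatrixInterp S d} {U : Set (Rule S V)}
    (hX : ∀ π ∈ U, π.lhs.funs ⊆ X ∧ π.rhs.funs ⊆ X) (hU : Orients A.TermGE U)
    (α : V → Fin d → ℕ) {s t : Term S V} (h : Step U s t) :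
    A.eval α (t.strip X x) ≤ A.eval α (s.strip X x) := by
  induction h with
  | root π hπ σ =>
    rw [Term.strip_subst σ (hX π hπ).1, Term.strip_subst σ (hX π hπ).2, eval_subst, eval_subst]
    exact hU π hπ _
  | arg f ts i u h ih =>
    by_cases hf : f ∈ X
    · have e := Term.strip_update (x := x) hf ts i (ts i)
      rw [Function.update_eq_self] at e
      rw [Term.strip_update hf, e, eval_update, eval_update]
      refine A.interp_mono f fun j => ?_
      rcases eq_or_ne j i with rfl | hne
      · simpa using ih
      · simp [Function.update_of_ne hne]
    · simp [Term.strip, hf]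

end MatrixInterp

end Weights

/-! ### Weights along dependency pair steps -/

section PairWeights

variable {S : Signature.{u}} {V : Type v} {d : ℕ} [NeZero d] {X : Set (dpSignature S V).symbol}
  {x : V} {P Q : Set (Rule (dpSignature S V) V)}

theorem CompoundClosure.toStep {s t : Term (dpSignature S V) V}
    (h : CompoundClosure (RootStep P) s t) : Step P s t := by
  induction h with
  | root s t h =>
    obtain ⟨π, hπ, σ, rfl, rfl⟩ := h
    exact .root π hπ σ
  | arg ρ n ts i u _ ih => exact .arg (S := dpSignature S V) (.com ρ n) ts i u ih

/-- Unit matrices make the first component of a compound term the sum of the first components of its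
arguments plus a constant, so the compound context does not amplify the gap `Δ`. -/
theorem MatrixInterp.eval_strip_le_add {A : MatrixInterp (dpSignature S V) d}
    (hA : A.IsAdequate) {Δ : ℕ}
    (hΔ : ∀ π ∈ P, ∀ α : V → Fin d → ℕ, A.eval α π.rhs 0 - A.eval α π.lhs 0 ≤ Δ)
    (hX : ∀ π ∈ P, π.lhs.funs ⊆ X ∧ π.rhs.funs ⊆ X) (hcom : ∀ ρ n, DPSymbol.com ρ n ∈ X)
    (α : V → Fin d → ℕ) {s t : Term (dpSignature S V) V}
    (h : CompoundClosure (RootStep P) s t) :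
    A.eval α (t.strip X x) 0 ≤ A.eval α (s.strip X x) 0 + Δ := by
  induction h with
  | root s t h =>
    obtain ⟨π, hπ, σ, rfl, rfl⟩ := h
    rw [Term.strip_subst σ (hX π hπ).1, Term.strip_subst σ (hX π hπ).2, eval_subst, eval_subst]
    exact Nat.sub_le_iff_le_add'.1 (hΔ π hπ _)
  | arg ρ n ts i u _ ih =>
    have e := Term.strip_update (S := dpSignature S V) (x := x) (hcom ρ n) ts i (ts i)
    rw [Function.update_eq_self] at e
    rw [Term.strip_update (S := dpSignature S V) (hcom ρ n), e]
    have hsum : ∀ y : Fin n → Fin d → ℕ, A.interp (.com ρ n) y 0 =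
        ∑ i, y i 0 + A.vec (.com ρ n) 0 := fun y => by
      have h1 : ∀ i : Fin n, A.mat (.com ρ n) i = 1 := hA ρ n
      simp only [interp, Pi.add_apply, Finset.sum_apply]
      congr 1
      exact Finset.sum_congr rfl fun i _ => by rw [h1 i, Matrix.one_mulVec]
    rw [eval_update, eval_update, hsum, hsum]
    have hadd : ∀ y : Fin d → ℕ, ∑ j, Function.update
        (fun j => A.eval α ((ts j).strip X x)) i y j 0 =
        y 0 + ∑ j ∈ Finset.univ \ {i}, A.eval α ((ts j).strip X x) 0 := fun y => by
      rw [Finset.sum_eq_add_sum_sdiff_singleton_of_mem (Finset.mem_univ i)]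
      congr 1
      · simp
      · refine Finset.sum_congr rfl fun j hj => ?_
        rw [Function.update_of_ne (by simpa using hj)]
    have h1 := hadd (A.eval α (u.strip X x))
    have h2 := hadd (A.eval α ((ts i).strip X x))
    calc _ = A.eval α (u.strip X x) 0 + _ + A.vec (.com ρ n) 0 := congrArg (· + _) h1
      _ ≤ A.eval α ((ts i).strip X x) 0 +
          ∑ j ∈ Finset.univ \ {i}, A.eval α ((ts j).strip X x) 0 + A.vec (.com ρ n) 0 + Δ := by
        omega
      _ = _ := congrArg (· + _ + _) h2.symm

/-- A complexity pair supplies monotonicity of the order on terms, not of the interpretation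
functions on vectors. The induction therefore compares terms under all assignments, for which it
matters that stripping yields terms again. -/
theorem MatrixInterp.termGT_strip {B : MatrixInterp (dpSignature S V) d}
    {μ : ReplacementMap (dpSignature S V)} (hP : Orients B.TermGT P) (hPQ : P ⊆ Q)
    (hX : ∀ π ∈ P, π.lhs.funs ⊆ X ∧ π.rhs.funs ⊆ X) (hcom : ∀ ρ n, DPSymbol.com ρ n ∈ X)
    (hmono : ∀ (ρ : Rule S V) (n : ℕ) (i : Fin n), i ∈ μ (.com ρ n) →
      MonotoneInArg (S := dpSignature S V) (V := V) B.TermGT (.com ρ n) i)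
    {s t : Term (dpSignature S V) V} (h : CompoundClosure (RootStep P) s t) :
    FrozenNormal μ Q s → B.TermGT (s.strip X x) (t.strip X x) := by
  induction h with
  | root s t h =>
    intro _ α
    obtain ⟨π, hπ, σ, rfl, rfl⟩ := h
    rw [Term.strip_subst σ (hX π hπ).1, Term.strip_subst σ (hX π hπ).2, eval_subst, eval_subst]
    exact hP π hπ _
  | arg ρ n ts i u h ih =>
    intro hs
    have hi := FrozenNormal.mem_map (S := dpSignature S V) (f := .com ρ n) hs
      (h.toStep.mono hPQ)
    have e := Term.strip_update (S := dpSignature S V) (x := x) (hcom ρ n) ts i (ts i)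
    rw [Function.update_eq_self] at e
    rw [Term.strip_update (S := dpSignature S V) (hcom ρ n), e]
    exact hmono ρ n i hi _ _ _
      (ih (FrozenNormal.of_arg (S := dpSignature S V) (f := .com ρ n) hs i))

end PairWeights

/-! ### The weight bound for derivations from basic terms -/

section Derivations

variable {S : Signature.{u}} {V : Type v} {st : Strategy} {R : Set (Rule S V)}

/-- The symbols of the rules of `R`. -/
def ruleFuns (R : Set (Rule S V)) : Set S.symbol := ⋃ ρ ∈ R, ρ.lhs.funs ∪ ρ.rhs.funs

theorem IsTRS.ruleFuns_finite (hR : IsTRS R) : (ruleFuns R).Finite :=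
  hR.finite.biUnion fun ρ _ => ρ.lhs.funs_finite.union ρ.rhs.funs_finite

theorem defined_subset_ruleFuns : defined R ⊆ ruleFuns R := by
  rintro f ⟨ρ, hρ, ts, h⟩
  refine Set.mem_biUnion hρ (Or.inl ?_)
  rw [h, Term.funs]
  exact Or.inl rfl

/-- The extended symbols without the unmarked symbols that do not occur in `R`. -/
def relevantSymbols (R : Set (Rule S V)) : Set (dpSignature S V).symbol :=
  {g | ∀ f, g = DPSymbol.base f → f ∈ ruleFuns R}

theorem Term.funs_lift_subset {t : Term S V} (h : t.funs ⊆ ruleFuns R) :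
    t.lift.funs ⊆ relevantSymbols R := by
  rw [Term.funs_lift]
  rintro _ ⟨g, hg, rfl⟩ f e
  cases e
  exact h hg

theorem Term.funs_sharp_subset {t : Term S V} (h : t.funs ⊆ ruleFuns R) :
    t.sharp.funs ⊆ relevantSymbols R := by
  cases t with
  | var x => simp [Term.sharp, Term.funs]
  | app f ts =>
    rw [Term.sharp, Term.funs]
    refine Set.union_subset ?_ (Set.iUnion_subset fun i => Term.funs_lift_subset ?_)
    · rintro g hg k e
      rw [Set.mem_singleton_iff.1 hg] at e
      cases e
    · rw [Term.funs] at h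
      exact fun g hg => h (Or.inr (Set.mem_iUnion.2 ⟨i, hg⟩))

theorem funs_compound_subset (ρ : Rule S V) {us : List (Term (dpSignature S V) V)}
    (h : ∀ u ∈ us, u.funs ⊆ relevantSymbols R) : (compound ρ us).funs ⊆ relevantSymbols R := by
  by_cases hl : us.length = 1
  · obtain ⟨v, rfl⟩ := List.length_eq_one_iff.1 hl
    exact h v (List.mem_singleton_self v)
  · rw [compound_of_length_ne_one ρ us hl, Term.funs]
    refine Set.union_subset ?_ (Set.iUnion_subset fun i => h _ (List.get_mem us i))
    rintro g hg k e
    rw [Set.mem_singleton_iff.1 hg] at e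
    cases e

theorem funs_dpSystem_subset : ∀ π ∈ dpSystem st R,
    π.lhs.funs ⊆ relevantSymbols R ∧ π.rhs.funs ⊆ relevantSymbols R := by
  have hl : ∀ ρ ∈ R, ρ.lhs.funs ⊆ ruleFuns R := fun ρ hρ =>
    Set.subset_union_left.trans (Set.subset_biUnion_of_mem (u := fun ρ : Rule S V =>
      ρ.lhs.funs ∪ ρ.rhs.funs) hρ)
  have hr : ∀ ρ ∈ R, ρ.rhs.funs ⊆ ruleFuns R := fun ρ hρ =>
    Set.subset_union_right.trans (Set.subset_biUnion_of_mem (u := fun ρ : Rule S V =>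
      ρ.lhs.funs ∪ ρ.rhs.funs) hρ)
  rintro π (⟨ρ, hρ, rfl⟩ | h)
  · refine ⟨Term.funs_sharp_subset (hl ρ hρ), funs_compound_subset ρ fun u hu => ?_⟩
    obtain ⟨t, ht, rfl⟩ := List.mem_map.1 hu
    exact Term.funs_sharp_subset
      ((hasSubterm_of_mem_outermost ht).funs_subset.trans (hr ρ hρ))
  · obtain ⟨ρ, hρ, rfl⟩ := usableRules_subset _ h
    exact ⟨Term.funs_lift_subset (hl ρ hρ), Term.funs_lift_subset (hr ρ hρ)⟩

theorem exists_length_le_eval_strip (hR : IsTRS R) {dA dB : ℕ} [NeZero dA] [NeZero dB]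
    {A : MatrixInterp (dpSignature S V) dA} {B : MatrixInterp (dpSignature S V) dB}
    (hBmono : ∀ (ρ : Rule S V) (n : ℕ) (i : Fin n), i ∈ dpUsableMap st R (.com ρ n) →
      MonotoneInArg (S := dpSignature S V) (V := V) B.TermGT (.com ρ n) i)
    (hBU : Orients B.TermGE (usableRules R (dependencyPairs st R)))
    (hBP : Orients B.TermGT (dependencyPairs st R))
    (hA : A.IsAdequate) (hAmono : A.IsMuMonotone (dpUsableMap st R))
    (hAgap : A.HasWeightGap (dependencyPairs st R))
    (hAU : Orients A.TermGT (usableRules R (dependencyPairs st R))) (x : V) :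
    ∃ Δ : ℕ, ∀ s ∈ basicTerms R, ∀ n t, Steps (st.step R) n s t →
      n ≤ A.eval 0 (s.sharp.strip (relevantSymbols R) x) 0 +
        (Δ + 1) * B.eval 0 (s.sharp.strip (relevantSymbols R) x) 0 := by
  obtain ⟨Δ, hΔ⟩ := hAgap
  have : Nonempty V := ⟨x⟩
  have hμ : ∀ f, ∀ i ∈ dpUsableMap st R f, f ∈ relevantSymbols R := fun f i hi => by
    obtain ⟨π, hπ, hf⟩ := Strategy.exists_mem_funs_of_mem_usableMap (S := dpSignature S V) hi
    exact (funs_dpSystem_subset π hπ).2 hf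
  have hcom : ∀ (ρ : Rule S V) n, DPSymbol.com ρ n ∈ relevantSymbols R := by
    intro ρ n f e
    cases e
  have hXU : ∀ π ∈ usableRules R (dependencyPairs st R),
      π.lhs.funs ⊆ relevantSymbols R ∧ π.rhs.funs ⊆ relevantSymbols R :=
    fun π h => funs_dpSystem_subset π (Or.inr h)
  have hXP : ∀ π ∈ dependencyPairs st R,
      π.lhs.funs ⊆ relevantSymbols R ∧ π.rhs.funs ⊆ relevantSymbols R :=
    fun π h => funs_dpSystem_subset (st := st) π (Or.inl h)
  refine ⟨Δ, fun s hs n t h => length_le_of_basic hR (st := st)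
    (wA := fun s => A.eval 0 (s.strip (relevantSymbols R) x) 0)
    (wB := fun s => B.eval 0 (s.strip (relevantSymbols R) x) 0)
    (fun s t h1 h2 => ⟨?_, ?_⟩) (fun s t h1 _ h2 => ⟨?_, ?_⟩) hs h⟩
  · exact (MatrixInterp.vecGT_eval_strip_of_step hAmono hμ hXU hAU Set.subset_union_right
      0 h2 h1).1
  · exact MatrixInterp.eval_strip_le_of_step hXU hBU 0 h2 0
  · exact MatrixInterp.eval_strip_le_add hA (fun π hπ α => hΔ ⟨π, hπ, α, rfl⟩) hXP hcom 0 h2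
  · exact (MatrixInterp.termGT_strip hBP Set.subset_union_left hXP hcom hBmono h2 h1 0).1

end Derivations

/-! ### The degree of restricted matrix interpretations -/

section Degree

variable {S : Signature.{u}} {V : Type v} {R : Set (Rule S V)} {d : ℕ}

namespace MatrixInterp

theorem exists_mat_vec_bound (A : MatrixInterp (dpSignature S V) d) {T : Set S.symbol}
    (hT : T.Finite) (F : S.symbol → DPSymbol S V) (j : Fin d) :
    ∃ C, ∀ f ∈ T, ∑ i, ∑ k, A.mat (F f) i j k + A.vec (F f) j ≤ C := by
  refine ⟨∑ f ∈ hT.toFinset, (∑ i, ∑ k, A.mat (F f) i j k + A.vec (F f) j), fun f hf => ?_⟩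
  exact Finset.single_le_sum (f := fun f => ∑ i, ∑ k, A.mat (F f) i j k + A.vec (F f) j)
    (fun _ _ => Nat.zero_le _) (hT.mem_toFinset.2 hf)

/-- By triangularity, component `j` of `f(t₁, …, tₙ)` depends on component `j` of the `tᵢ` through
the diagonal entries and otherwise on later components, which are bounded by induction. Without a
diagonal one there is no recursion and the exponent stays; with one, the contributions of all
subterms add up and cost one more factor `t.size`. -/
theorem exists_eval_lift_le {A : MatrixInterp (dpSignature S V) d} (hA : A.IsRMI R)
    (hR : IsTRS R) {x : V} {J : Finset (Fin d)}
    (hJ : ∀ j ∉ J, ∀ f ∉ defined R, ∀ i, A.mat (.base f) i j j = 0) (j : Fin d) :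
    ∃ c, ∀ t : Term S V, Disjoint t.funs (defined R) →
      A.eval 0 (t.lift.strip (relevantSymbols R) x) j ≤
        c * t.size ^ (J.filter (j ≤ ·)).card := by
  induction j using WellFoundedGT.induction with
  | ind j ih =>
  choose! c hc using ih
  set D := (J.filter (j < ·)).card with hD
  obtain ⟨C₂, hC₂⟩ := A.exists_mat_vec_bound hR.ruleFuns_finite .base j
  -- Only the `c k` with `k > j` carry information; the sum over all `k` is a common upper bound for
  -- them.
  have hc' : ∀ k > j, ∀ t : Term S V, Disjoint t.funs (defined R) →
      A.eval 0 (t.lift.strip (relevantSymbols R) x) k ≤ (∑ k, c k) * t.size ^ D := by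
    intro k hk t ht
    refine (hc k hk t ht).trans (Nat.mul_le_mul
      (Finset.single_le_sum (fun _ _ => Nat.zero_le _) (Finset.mem_univ k))
      (Nat.pow_le_pow_right t.size_pos (Finset.card_le_card fun l hl => ?_)))
    rw [Finset.mem_filter] at hl ⊢
    exact ⟨hl.1, hk.trans_le hl.2⟩
  set C := C₂ * (∑ k, c k) + C₂ with hC
  have main : ∀ (f : S.symbol) (ts : Fin (S.arity f) → Term S V), f ∈ ruleFuns R →
      Disjoint (Term.app f ts).funs (defined R) →
      A.eval 0 ((Term.app f ts).lift.strip (relevantSymbols R) x) j ≤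
        ∑ i, A.mat (.base f) i j j *
          A.eval 0 ((ts i).lift.strip (relevantSymbols R) x) j +
        C * (Term.app f ts).size ^ D := by
    intro f ts hf hd
    have hfd : f ∉ defined R := fun h => by
      rw [Term.funs] at hd
      exact Set.disjoint_left.1 hd (Or.inl rfl) h
    have hd' : ∀ i, Disjoint (ts i).funs (defined R) := fun i =>
      hd.mono_left (Term.hasSubterm_refl (ts i)).of_arg.funs_subset
    have hrel : (DPSymbol.base f : DPSymbol S V) ∈ relevantSymbols R := fun g e => by
      cases e; exact hf
    set s := (Term.app f ts).size
    rw [Term.lift, Term.strip, if_pos hrel, eval, interp_apply]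
    have hterm : ∀ (i : Fin (S.arity f)) (k : Fin d), A.mat (.base f) i j k *
        A.eval 0 ((ts i).lift.strip (relevantSymbols R) x) k ≤
        (if k = j then A.mat (.base f) i j j *
          A.eval 0 ((ts i).lift.strip (relevantSymbols R) x) j else 0) +
        A.mat (.base f) i j k * ((∑ k, c k) * s ^ D) := by
      intro i k
      rcases lt_trichotomy k j with h | rfl | h
      · rw [(hA f hfd i).1 j k h]; simp
      · simp
      · rw [if_neg h.ne', zero_add]
        refine Nat.mul_le_mul_left _ ((hc' k h (ts i) (hd' i)).trans ?_)
        exact Nat.mul_le_mul_left _ (Nat.pow_le_pow_left (Term.size_arg_le f ts i) D)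
    have hs : 1 ≤ s ^ D := Nat.one_le_pow _ _ (Term.size_pos _)
    have h2 := hC₂ f hf
    calc _ ≤ ∑ i : Fin (S.arity f), ∑ k, ((if k = j then A.mat (.base f) i j j *
          A.eval 0 ((ts i).lift.strip (relevantSymbols R) x) j else 0) +
          A.mat (.base f) i j k * ((∑ k, c k) * s ^ D)) + A.vec (.base f) j :=
        Nat.add_le_add_right (Finset.sum_le_sum fun i _ => Finset.sum_le_sum fun k _ =>
          hterm i k) _
      _ = ∑ i : Fin (S.arity f), A.mat (.base f) i j j *
            A.eval 0 ((ts i).lift.strip (relevantSymbols R) x) j +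
          ((∑ i : Fin (S.arity f), ∑ k, A.mat (.base f) i j k) * ((∑ k, c k) * s ^ D) +
            A.vec (.base f) j) := by
        simp only [Finset.sum_add_distrib, Finset.sum_ite_eq', Finset.mem_univ, if_true,
          Finset.sum_mul]
        rw [add_assoc]
      _ ≤ _ := by
        refine Nat.add_le_add_left ?_ _
        calc _ ≤ C₂ * ((∑ k, c k) * s ^ D) + C₂ * s ^ D :=
              Nat.add_le_add (Nat.mul_le_mul_right _ ((Nat.le_add_right _ _).trans h2))
                (((Nat.le_add_left _ _).trans h2).trans (Nat.le_mul_of_pos_right _ hs))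
          _ = C * s ^ D := by rw [hC]; ring
  have hvar : ∀ y, A.eval 0 ((Term.var y : Term S V).lift.strip (relevantSymbols R) x) j = 0 := by
    intro y
    simp [Term.lift, Term.strip, eval]
  have hirr : ∀ (f : S.symbol) (ts : Fin (S.arity f) → Term S V), f ∉ ruleFuns R →
      A.eval 0 ((Term.app f ts).lift.strip (relevantSymbols R) x) j = 0 := by
    intro f ts hf
    have hrel : (DPSymbol.base f : DPSymbol S V) ∉ relevantSymbols R := fun h => hf (h f rfl)
    rw [Term.lift, Term.strip, if_neg hrel]
    simp [eval]
  have hsub : ∀ {f : S.symbol} {ts : Fin (S.arity f) → Term S V},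
      Disjoint (Term.app f ts).funs (defined R) → f ∉ defined R ∧
        ∀ i, Disjoint (ts i).funs (defined R) := fun {f ts} hd => by
    refine ⟨fun h => ?_, fun i =>
      hd.mono_left (Term.hasSubterm_refl (ts i)).of_arg.funs_subset⟩
    rw [Term.funs] at hd
    exact Set.disjoint_left.1 hd (Or.inl rfl) h
  refine ⟨C, fun t => ?_⟩
  by_cases hj : j ∈ J
  · have hcard : (J.filter (j ≤ ·)).card = D + 1 := by
      have : J.filter (j ≤ ·) = insert j (J.filter (j < ·)) := by
        ext l
        simp only [Finset.mem_filter, Finset.mem_insert, le_iff_eq_or_lt]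
        constructor
        · rintro ⟨h1, rfl | h2⟩
          · exact Or.inl rfl
          · exact Or.inr ⟨h1, h2⟩
        · rintro (rfl | ⟨h1, h2⟩)
          · exact ⟨hj, Or.inl rfl⟩
          · exact ⟨h1, Or.inr h2⟩
      rw [this, Finset.card_insert_of_notMem (by simp)]
    rw [hcard]
    induction t with
    | var y => intro _; rw [hvar]; exact Nat.zero_le _
    | app f ts iht =>
      intro hd
      by_cases hf : f ∈ ruleFuns R
      · obtain ⟨hfd, hd'⟩ := hsub hd
        refine (main f ts hf hd).trans ?_
        set s := (Term.app f ts).size with hs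
        -- The constant does not grow along the recursion: the root contributes `C * s ^ D`, which
        -- is the share of the summand `1` in `1 + ∑ i, (ts i).size`.
        calc _ ≤ ∑ i, C * s ^ D * (ts i).size + C * s ^ D := by
              refine Nat.add_le_add_right (Finset.sum_le_sum fun i _ => ?_) _
              calc _ ≤ 1 * (C * (ts i).size ^ (D + 1)) :=
                    Nat.mul_le_mul ((hA f hfd i).2 j) (iht i (hd' i))
                _ = C * (ts i).size ^ D * (ts i).size := by ring
                _ ≤ _ := by gcongr; exact Term.size_arg_le f ts i
          _ = C * s ^ D * (1 + ∑ i, (ts i).size) := by rw [← Finset.mul_sum]; ring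
          _ = C * s ^ (D + 1) := by
            rw [hs, Term.size]; ring
      · rw [hirr f ts hf]; exact Nat.zero_le _
  · have hcard : (J.filter (j ≤ ·)).card = D := by
      congr 1
      ext l
      simp only [Finset.mem_filter, and_congr_right_iff]
      intro hl
      exact ⟨fun h => lt_of_le_of_ne h fun e => hj (e ▸ hl), le_of_lt⟩
    rw [hcard]
    cases t with
    | var y => intro _; rw [hvar]; exact Nat.zero_le _
    | app f ts =>
      intro hd
      by_cases hf : f ∈ ruleFuns R
      · refine (main f ts hf hd).trans (le_of_eq ?_)
        rw [Finset.sum_eq_zero fun i _ => by rw [hJ j hj f (hsub hd).1 i, zero_mul], zero_add]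
      · rw [hirr f ts hf]; exact Nat.zero_le _

/-- The marked root has unrestricted matrices, but it is applied only once and there are finitely
many defined symbols, so it affects the constant and not the exponent. -/
theorem exists_eval_sharp_le {A : MatrixInterp (dpSignature S V) d} (hA : A.IsRMI R)
    (hR : IsTRS R) (x : V) (j : Fin d) :
    ∃ c, ∀ t ∈ basicTerms R, A.eval 0 (t.sharp.strip (relevantSymbols R) x) j ≤
      c * t.size ^ A.diagonalOnes R := by
  set J : Finset (Fin d) := Finset.univ.filter fun j =>
    ∃ f, f ∉ defined R ∧ ∃ i, A.mat (.base f) i j j = 1 with hJdef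
  have hcard : A.diagonalOnes R = J.card := by
    rw [diagonalOnes, Set.ncard_eq_toFinset_card', Set.toFinset_ofPred]
  have hJ : ∀ j ∉ J, ∀ f ∉ defined R, ∀ i, A.mat (.base f) i j j = 0 := by
    intro j hj f hf i
    have h1 := (hA f hf i).2 j
    have h2 : A.mat (.base f) i j j ≠ 1 := fun h =>
      hj (Finset.mem_filter.2 ⟨Finset.mem_univ _, f, hf, i, h⟩)
    omega
  choose c hc using fun j => exists_eval_lift_le hA hR (x := x) hJ j
  obtain ⟨C, hC⟩ := A.exists_mat_vec_bound
    (hR.ruleFuns_finite.subset defined_subset_ruleFuns) .sharp j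
  rw [hcard]
  refine ⟨C * (∑ k, c k) + C, ?_⟩
  rintro _ ⟨f, ts, rfl, hf, hd⟩
  have hrel : (DPSymbol.sharp f : DPSymbol S V) ∈ relevantSymbols R := fun g e => by cases e
  set s := (Term.app f ts).size
  rw [Term.sharp, Term.strip, if_pos hrel, eval, interp_apply]
  have hle : ∀ (i : Fin (S.arity f)) k, A.eval 0 ((ts i).lift.strip (relevantSymbols R) x) k ≤
      (∑ k, c k) * s ^ J.card := fun i k =>
    (hc k (ts i) (hd i)).trans (Nat.mul_le_mul
      (Finset.single_le_sum (fun _ _ => Nat.zero_le _) (Finset.mem_univ k))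
      ((Nat.pow_le_pow_left (Term.size_arg_le f ts i) _).trans
        (Nat.pow_le_pow_right (Term.size_pos _) (Finset.card_le_card (Finset.filter_subset _ _)))))
  have hs : 1 ≤ s ^ J.card := Nat.one_le_pow _ _ (Term.size_pos _)
  have h2 := hC f hf
  calc _ ≤ ∑ i : Fin (S.arity f), ∑ k, A.mat (.sharp f) i j k * ((∑ k, c k) * s ^ J.card) +
        A.vec (.sharp f) j :=
      Nat.add_le_add_right (Finset.sum_le_sum fun i _ => Finset.sum_le_sum fun k _ =>
        Nat.mul_le_mul_left _ (hle i k)) _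
    _ = (∑ i : Fin (S.arity f), ∑ k, A.mat (.sharp f) i j k) * ((∑ k, c k) * s ^ J.card) +
        A.vec (.sharp f) j := by simp only [Finset.sum_mul]
    _ ≤ C * ((∑ k, c k) * s ^ J.card) + C * s ^ J.card :=
      Nat.add_le_add (Nat.mul_le_mul_right _ ((Nat.le_add_right _ _).trans h2))
        (((Nat.le_add_left _ _).trans h2).trans (Nat.le_mul_of_pos_right _ hs))
    _ = _ := by ring

end MatrixInterp

theorem exists_polynomial_of_length_le {st : Strategy} {K c : ℕ}
    (h : ∀ s ∈ basicTerms R, ∀ n t, Steps (st.step R) n s t → n ≤ c * s.size ^ K) :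
    ∃ p : Polynomial ℕ, p.natDegree ≤ K ∧
      ∀ n : ℕ, runtimeComplexity st R n ≤ (p.eval n : ℕ) := by
  refine ⟨Polynomial.C c * Polynomial.X ^ K, Polynomial.natDegree_C_mul_X_pow_le c K, fun n => ?_⟩
  refine iSup₂_le fun s ⟨hs, hn⟩ => iSup₂_le fun m ⟨t, ht⟩ => ?_
  simp only [Polynomial.eval_mul, Polynomial.eval_C, Polynomial.eval_pow, Polynomial.eval_X]
  have hm : m ≤ c * n ^ K :=
    (h s hs m t ht).trans (Nat.mul_le_mul_left c (Nat.pow_le_pow_left hn K))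
  exact Nat.cast_le.2 hm

theorem mul_pow_add_mul_pow_le {a b m n s kA kB e : ℕ} (hs : 0 < s) (ha : m ≤ a * s ^ kA)
    (hb : n ≤ b * s ^ kB) : m + e * n ≤ (a + e * b) * s ^ max kA kB :=
  calc m + e * n ≤ a * s ^ max kA kB + e * (b * s ^ max kA kB) := by
        refine Nat.add_le_add (ha.trans ?_) (Nat.mul_le_mul_left _ (hb.trans ?_))
        · exact Nat.mul_le_mul_left _ (Nat.pow_le_pow_right hs (le_max_left _ _))
        · exact Nat.mul_le_mul_left _ (Nat.pow_le_pow_right hs (le_max_right _ _))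
    _ = _ := by ring

end Degree

end Rewriting

/-! ### The complexity bounds -/

open Rewriting
theorem corollaryc {S : Signature.{u}} {V : Type v} [Countable V] [Infinite V]
    (R : Set (Rule S V)) (hR : IsTRS R) (st : Strategy)
    {dA dB : ℕ} [NeZero dA] [NeZero dB]
    (A : MatrixInterp (dpSignature S V) dA) (B : MatrixInterp (dpSignature S V) dB)
    (hB : B.IsRMI R)
    (hBpair : IsComplexityPair (dpUsableMap st R) (dependencyPairs st R)
      (usableRules R (dependencyPairs st R)) B.TermGE B.TermGT)
    (hBU : Orients B.TermGE (usableRules R (dependencyPairs st R)))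
    (hBP : Orients B.TermGT (dependencyPairs st R))
    (hA : A.IsRMI R)
    (hAadequate : A.IsAdequate)
    (hAmono : A.IsMuMonotone (dpUsableMap st R))
    (hAgap : A.HasWeightGap (dependencyPairs st R))
    (hAU : Orients A.TermGT (usableRules R (dependencyPairs st R))) :
    (∀ kA kB : ℕ, A.IsOfBasicDegree R kA → B.IsOfBasicDegree R kB →
      ∃ p : Polynomial ℕ, p.natDegree ≤ max kA kB ∧
        ∀ n : ℕ, runtimeComplexity st R n ≤ (p.eval n : ℕ)) ∧
    (∃ p : Polynomial ℕ, p.natDegree ≤ max (A.diagonalOnes R) (B.diagonalOnes R) ∧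
      ∀ n : ℕ, runtimeComplexity st R n ≤ (p.eval n : ℕ)) := by
  have x : V := Classical.arbitrary V
  obtain ⟨Δ, hΔ⟩ := exists_length_le_eval_strip hR hBpair.gt_monotone hBU hBP hAadequate hAmono
    hAgap hAU x
  constructor
  · rintro kA kB ⟨a, ha⟩ ⟨b, hb⟩
    refine exists_polynomial_of_length_le (c := a + (Δ + 1) * b) fun s hs n t h =>
      (hΔ s hs n t h).trans (mul_pow_add_mul_pow_le s.size_pos ?_ ?_)
    · exact (A.eval_strip_le s.sharp 0).trans (s.size_sharp ▸ ha s hs 0)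
    · exact (B.eval_strip_le s.sharp 0).trans (s.size_sharp ▸ hb s hs 0)
  · obtain ⟨a, ha⟩ := A.exists_eval_sharp_le hA hR x 0
    obtain ⟨b, hb⟩ := B.exists_eval_sharp_le hB hR x 0
    exact exists_polynomial_of_length_le fun s hs n t h =>
      (hΔ s hs n t h).trans (mul_pow_add_mul_pow_le s.size_pos (ha s hs) (hb s hs))
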